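/- Let $\omega:\mathbb{R}^d\to[0,\infty)$ be a measurable even function with $\omega(0)=0$ such that $(\alpha)$ $\omega(\xi_1+\xi_2)\le\omega(\xi_1)+\omega(\xi_2)$ for all $\xi_1,\xi_2$; $(\beta)$ $\int_{|\xi|>1}\omega(\xi)|\xi|^{-d-1}\,d\xi<\infty$; $(\gamma)$ there are $a\in\mathbb{R}$, $C>0$ with $\omega(\xi)\ge a+C\log(1+|\xi|)$ for all $\xi$. In all statements on the Roumieu type $\{\omega\}$ assume moreover $(\gamma_0)$: $\omega(\xi)/\log(1+|\xi|)\to\infty$ as $|\xi|\to\infty$. For compact $K\subset\mathbb{R}^d$ and $\lambda>0$ let $\mathcal{D}^\lambda_\omega(K)$ be the Banach space of all $\varphi\in L^1(\mathbb{R}^d)$ with $\operatorname{supp}\varphi\subseteq K$ and $\|\varphi\|_\lambda=\sup_{\xi}|\widehat\varphi(\xi)|e^{\lambda\omega(\xi)}<\infty$, where $\widehat\varphi(\xi)=\int\varphi(x)e^{-2\pi i x\cdot\xi}\,dx$. Let $\mathcal{D}_{(\omega)}(\mathbb{R}^d)=\varinjlim_{K}\varprojlim_{\lambda\to\infty}\mathcal{D}^\lambda_\omega(K)$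 and $\mathcal{D}_{\{\omega\}}(\mathbb{R}^d)=\varinjlim_{K}\varinjlim_{\lambda\to0^+}\mathcal{D}^\lambda_\omega(K)$ (locally convex limits), and let $\mathcal{D}'_{(\omega)}(\mathbb{R}^d)$, $\mathcal{D}'_{\{\omega\}}(\mathbb{R}^d)$ be their strong duals. Let $\Lambda\subset\mathbb{R}^d$ be a lattice (a discrete subgroup spanning $\mathbb{R}^d$) with covolume $|\Lambda|$, let $\Lambda^*=\{y\in\mathbb{R}^d: y\cdot x\in\mathbb{Z}\ \forall x\in\Lambda\}$, and put $e_y(x)=e^{2\pi i y\cdot x}$. Let $\mathcal{D}'_{\mathfrak{p}_\Lambda,(\omega)}$ and $\mathcal{D}'_{\mathfrak{p}_\Lambda,\{\omega\}}$ be the subspaces (with the induced topology) of all $f$ in $\mathcal{D}'_{(\omega)}(\mathbb{R}^d)$, resp. $\mathcal{D}'_{\{\omega\}}(\mathbb{R}^d)$, with $f(\cdot+\mu)=f$ for all $\mu\in\Lambda$. For $\kappa\in\mathbb{R}$ let $\mathcal{S}^\kappa_\omega(\Lambda^*)$ be the Banach space of all $(c_{\mu^*})\in\mathbb{C}^{\Lambda^*}$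 with $\sup_{\mu^*}|c_{\mu^*}|e^{\kappa\omega(\mu^*)}<\infty$. Let $\mathcal{S}_{(\omega)}(\Lambda^*)=\varprojlim_{\lambda\to\infty}\mathcal{S}^\lambda_\omega(\Lambda^*)$, $\mathcal{S}_{\{\omega\}}(\Lambda^*)=\varinjlim_{\lambda\to0^+}\mathcal{S}^\lambda_\omega(\Lambda^*)$, $\mathcal{S}'_{(\omega)}(\Lambda^*)=\varinjlim_{\lambda\to\infty}\mathcal{S}^{-\lambda}_\omega(\Lambda^*)$ and $\mathcal{S}'_{\{\omega\}}(\Lambda^*)=\varprojlim_{\lambda\to0^+}\mathcal{S}^{-\lambda}_\omega(\Lambda^*)$. Then there is $\eta\in\mathcal{D}_{(\omega)}(\mathbb{R}^d)$ with $\sum_{\mu\in\Lambda}\eta(x+\mu)=1$ for all $x\in\mathbb{R}^d$, and the following holds for the Beurling type $(\omega)$ and for the Roumieu type $\{\omega\}$. (i) For every $\Lambda$-periodic ultradistribution $f$ of the given type, the Fourier coefficients $$c_{\mu^*}(f)=\frac{1}{|\Lambda|}\langle f,\eta\,e_{-\mu^*}\rangle,\qquad \mu^*\in\Lambda^*,$$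 do not depend on the choice of a test function $\eta$ of the given type with $\sum_{\mu\in\Lambda}\eta(\cdot+\mu)=1$, and $$f=\sum_{\mu^*\in\Lambda^*}c_{\mu^*}(f)\,e_{\mu^*},$$ with unconditional convergence in $\mathcal{D}'_{(\omega)}(\mathbb{R}^d)$ (resp. in $\mathcal{D}'_{\{\omega\}}(\mathbb{R}^d)$). (ii) The mapping $f\mapsto(c_{\mu^*}(f))_{\mu^*\in\Lambda^*}$ is an isomorphism of topological vector spaces of $\mathcal{D}'_{\mathfrak{p}_\Lambda,(\omega)}$ onto $\mathcal{S}'_{(\omega)}(\Lambda^*)$ (resp. of $\mathcal{D}'_{\mathfrak{p}_\Lambda,\{\omega\}}$ onto $\mathcal{S}'_{\{\omega\}}(\Lambda^*)$). Here $\mathcal{S}'_{(\omega)}(\Lambda^*)$ (resp. $\mathcal{S}'_{\{\omega\}}(\Lambda^*)$) is, through the unconditionally convergent pairing $\langle c,s\rangle=\sum_{\mu^*}c_{\mu^*}s_{\mu^*}$, topologically isomorphic to the strong dual of $\mathcal{S}_{(\omega)}(\Lambda^*)$ (resp. of $\mathcal{S}_{\{\omega\}}(\Lambda^*)$). -/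

import Mathlib

open MeasureTheory Filter Topology
open scoped FourierTransform ENNReal NNReal RealInnerProductSpace

noncomputable section

namespace Ultra

/-- The Euclidean space `ℝᵈ`. -/
abbrev E (d : ℕ) : Type := EuclideanSpace ℝ (Fin d)

/-- An even weight function `ω : ℝᵈ → [0, ∞)` with `ω 0 = 0` satisfying the conditions `(α)`
(subadditivity), `(β)` (non-quasianalyticity) and `(γ)` (at least logarithmic growth). -/
structure Weight (d : ℕ) where
  toFun : E d → ℝ
  measurable : Measurable toFun
  nonneg : ∀ ξ, 0 ≤ toFun ξ
  even : ∀ ξ, toFun (-ξ) = toFun ξ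
  map_zero : toFun 0 = 0
  subadd : ∀ ξ₁ ξ₂, toFun (ξ₁ + ξ₂) ≤ toFun ξ₁ + toFun ξ₂
  beta : IntegrableOn (fun ξ => toFun ξ / ‖ξ‖ ^ (d + 1)) {ξ | 1 < ‖ξ‖} volume
  gamma : ∃ a C : ℝ, 0 < C ∧ ∀ ξ, a + C * Real.log (1 + ‖ξ‖) ≤ toFun ξ

instance (d : ℕ) : CoeFun (Weight d) (fun _ => E d → ℝ) := ⟨Weight.toFun⟩

/-- The condition `(γ₀)`: `ω(ξ) / log (1 + |ξ|) → ∞` as `|ξ| → ∞`. -/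
def Weight.GammaZero {d : ℕ} (ω : Weight d) : Prop :=
  Tendsto (fun ξ => ω ξ / Real.log (1 + ‖ξ‖)) (Bornology.cobounded (E d)) atTop

/-- The two types of ultradistribution theory: `(ω)` (Beurling) and `{ω}` (Roumieu). -/
inductive UType where
  | beurling
  | roumieu

/-- The quantifier over `λ > 0` in the definition of the test function spaces:
`∀ λ` for the Beurling type, `∃ λ` for the Roumieu type. -/
def UType.quant : UType → (ℝ → Prop) → Prop
  | .beurling, P => ∀ l : ℝ, 0 < l → P l
  | .roumieu, P => ∃ l : ℝ, 0 < l ∧ P l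

/-- The quantifier over `λ > 0` dual to `UType.quant`:
`∃ λ` for the Beurling type, `∀ λ` for the Roumieu type. -/
def UType.coquant : UType → (ℝ → Prop) → Prop
  | .beurling, P => ∃ l : ℝ, 0 < l ∧ P l
  | .roumieu, P => ∀ l : ℝ, 0 < l → P l

/-- The locally convex topology on `V` generated by all the seminorms in the set `S`. -/
abbrev seminormTopology {V : Type*} [AddCommGroup V] [Module ℂ V] (S : Set (Seminorm ℂ V)) :
    TopologicalSpace V :=
  SeminormFamily.moduleFilterBasis (fun p : S => (p : Seminorm ℂ V)) |>.topology

variable {d : ℕ}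

/-! ### Test functions -/

/-- `‖φ‖_λ = sup_ξ |φ̂(ξ)| e^{λ ω(ξ)}`, possibly infinite, where
`φ̂(ξ) = ∫ φ(x) e^{-2πi x·ξ} dx`. -/
def fnorm (ω : Weight d) (l : ℝ) (φ : E d → ℂ) : ℝ≥0∞ :=
  ⨆ ξ : E d, ENNReal.ofReal (‖𝓕 φ ξ‖ * Real.exp (l * ω ξ))

theorem fnorm_le_iff {ω : Weight d} {l : ℝ} {φ : E d → ℂ} {C : ℝ≥0∞} :
    fnorm ω l φ ≤ C ↔ ∀ ξ, ENNReal.ofReal (‖𝓕 φ ξ‖ * Real.exp (l * ω ξ)) ≤ C :=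
  iSup_le_iff

theorem fnorm_mono (ω : Weight d) {l m : ℝ} (h : l ≤ m) (φ : E d → ℂ) :
    fnorm ω l φ ≤ fnorm ω m φ := by
  refine iSup_mono fun ξ => ENNReal.ofReal_le_ofReal ?_
  have := ω.nonneg ξ
  gcongr

theorem UType.quant_and {t : UType} {P Q R : ℝ → Prop} (hP : t.quant P) (hQ : t.quant Q)
    (mP : ∀ l m, l ≤ m → P m → P l) (mQ : ∀ l m, l ≤ m → Q m → Q l)
    (h : ∀ l, P l → Q l → R l) : t.quant R := by
  cases t with
  | beurling => exact fun l hl => h l (hP l hl) (hQ l hl)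
  | roumieu =>
    obtain ⟨l, hl, hPl⟩ := hP
    obtain ⟨m, hm, hQm⟩ := hQ
    exact ⟨min l m, lt_min hl hm, h _ (mP _ _ (min_le_left _ _) hPl)
      (mQ _ _ (min_le_right _ _) hQm)⟩

theorem UType.quant_mono {t : UType} {P Q : ℝ → Prop} (hP : t.quant P)
    (h : ∀ l, 0 < l → P l → Q l) : t.quant Q := by
  cases t with
  | beurling => exact fun l hl => h l hl (hP l hl)
  | roumieu =>
    obtain ⟨l, hl, hPl⟩ := hP
    exact ⟨l, hl, h l hl hPl⟩

theorem UType.quant_of_forall (t : UType) {P : ℝ → Prop} (h : ∀ l, P l) : t.quant P := by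
  cases t with
  | beurling => exact fun l _ => h l
  | roumieu => exact ⟨1, one_pos, h 1⟩

theorem UType.coquant_of_forall (t : UType) {P : ℝ → Prop} (h : ∀ l, P l) : t.coquant P := by
  cases t with
  | beurling => exact ⟨1, one_pos, h 1⟩
  | roumieu => exact fun l _ => h l

theorem fourier_add' {φ ψ : E d → ℂ} (hφ : Integrable φ) (hψ : Integrable ψ) (ξ : E d) :
    𝓕 (φ + ψ) ξ = 𝓕 φ ξ + 𝓕 ψ ξ :=
  congrFun (VectorFourier.fourierIntegral_add Real.continuous_fourierChar
    (by exact continuous_inner) hφ hψ) ξ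

theorem fourier_smul' (c : ℂ) (φ : E d → ℂ) (ξ : E d) : 𝓕 (c • φ) ξ = c * 𝓕 φ ξ :=
  congrFun (VectorFourier.fourierIntegral_const_smul (W := E d) Real.fourierChar volume
    (innerₗ (E d)) φ c) ξ

theorem fnorm_add_le (ω : Weight d) (l : ℝ) {φ ψ : E d → ℂ} (hφ : Integrable φ)
    (hψ : Integrable ψ) : fnorm ω l (φ + ψ) ≤ fnorm ω l φ + fnorm ω l ψ := by
  refine fnorm_le_iff.2 fun ξ => ?_
  calc ENNReal.ofReal (‖𝓕 (φ + ψ) ξ‖ * Real.exp (l * ω ξ))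
      ≤ ENNReal.ofReal (‖𝓕 φ ξ‖ * Real.exp (l * ω ξ) + ‖𝓕 ψ ξ‖ * Real.exp (l * ω ξ)) := by
        apply ENNReal.ofReal_le_ofReal
        rw [fourier_add' hφ hψ, ← add_mul]
        gcongr
        exact norm_add_le _ _
    _ = _ := ENNReal.ofReal_add (by positivity) (by positivity)
    _ ≤ _ := add_le_add (fnorm_le_iff.1 le_rfl ξ) (fnorm_le_iff.1 le_rfl ξ)

theorem fnorm_smul_le (ω : Weight d) (l : ℝ) (c : ℂ) (φ : E d → ℂ) :
    fnorm ω l (c • φ) ≤ ENNReal.ofReal ‖c‖ * fnorm ω l φ := by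
  refine fnorm_le_iff.2 fun ξ => ?_
  rw [fourier_smul', norm_mul, mul_assoc, ENNReal.ofReal_mul (norm_nonneg _)]
  gcongr
  exact fnorm_le_iff.1 le_rfl ξ

/-- The space `𝓓_(ω)(ℝᵈ)`, resp. `𝓓_{ω}(ℝᵈ)`, as a space of functions: compactly supported `φ`
with `‖φ‖_λ < ∞` for all, resp. for some, `λ > 0`. (Elements are taken as continuous functions
and not as classes in `L¹`: by `(γ)`, resp. `(γ₀)`, and Fourier inversion each class has
exactly one continuous representative.) -/
def testSubmodule (t : UType) (ω : Weight d) : Submodule ℂ (E d → ℂ) where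
  carrier := {φ | Continuous φ ∧ HasCompactSupport φ ∧ t.quant fun l => fnorm ω l φ < ∞}
  zero_mem' := by
    refine ⟨continuous_zero, HasCompactSupport.zero, t.quant_of_forall fun l => ?_⟩
    have h := fnorm_smul_le ω l 0 (0 : E d → ℂ)
    rw [zero_smul, norm_zero, ENNReal.ofReal_zero, zero_mul] at h
    exact h.trans_lt ENNReal.zero_lt_top
  add_mem' := by
    rintro φ ψ ⟨h1, h2, h3⟩ ⟨k1, k2, k3⟩
    refine ⟨h1.add k1, h2.add k2, UType.quant_and h3 k3
      (fun l m h hm => (fnorm_mono ω h _).trans_lt hm)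
      (fun l m h hm => (fnorm_mono ω h _).trans_lt hm) fun l hl kl => ?_⟩
    exact (fnorm_add_le ω l (h1.integrable_of_hasCompactSupport h2)
      (k1.integrable_of_hasCompactSupport k2)).trans_lt (ENNReal.add_lt_top.2 ⟨hl, kl⟩)
  smul_mem' := by
    rintro c φ ⟨h1, h2, h3⟩
    refine ⟨h1.const_smul c, h2.smul_left (f := fun _ => c), UType.quant_mono h3 fun l _ hl => ?_⟩
    exact (fnorm_smul_le ω l c φ).trans_lt (ENNReal.mul_lt_top ENNReal.ofReal_lt_top hl)

/-- The space of test functions `𝓓_(ω)(ℝᵈ)`, resp. `𝓓_{ω}(ℝᵈ)`. It is a type of its own, so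
that it carries its inductive limit topology and not the topology of pointwise convergence. -/
def Test (t : UType) (ω : Weight d) : Type := testSubmodule t ω

namespace Test

variable {t : UType} {ω : Weight d}

instance : AddCommGroup (Test t ω) := inferInstanceAs (AddCommGroup (testSubmodule t ω))
instance : Module ℂ (Test t ω) := inferInstanceAs (Module ℂ (testSubmodule t ω))
instance : CoeFun (Test t ω) (fun _ => E d → ℂ) := ⟨fun φ => φ.1⟩

theorem integrable (φ : Test t ω) : Integrable φ :=
  φ.2.1.integrable_of_hasCompactSupport φ.2.2.1

variable (t ω) in
/-- The continuous seminorms of the inductive limits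
`𝓓_(ω)(ℝᵈ) = lim_{K} lim_{λ → ∞} 𝓓_ω^λ(K)` (inductive in `K`, projective in `λ`) and
`𝓓_{ω}(ℝᵈ) = lim_{K} lim_{λ → 0+} 𝓓_ω^λ(K)` (inductive in `K` and `λ`):
a seminorm on a locally convex inductive limit is continuous if and only if its restriction to
each step is, and on the step of a compact set `K` this means that it is bounded by a multiple of
`‖·‖_λ` for some `λ` (Beurling), resp. for every `λ` (Roumieu). -/
def contSeminorms : Set (Seminorm ℂ (Test t ω)) :=
  {p | ∀ K : Set (E d), IsCompact K → t.coquant fun l => ∃ C : ℝ≥0, ∀ φ : Test t ω,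
    tsupport φ ⊆ K → ENNReal.ofReal (p φ) ≤ C * fnorm ω l φ}

/-- The locally convex inductive limit topology of the space of test functions. -/
instance : TopologicalSpace (Test t ω) := seminormTopology (contSeminorms t ω)

instance : Nonempty (contSeminorms t ω) :=
  ⟨⟨0, fun _ _ => t.coquant_of_forall fun _ => ⟨0, fun _ _ => by simp⟩⟩⟩

theorem withSeminorms :
    WithSeminorms (fun p : contSeminorms t ω => (p : Seminorm ℂ (Test t ω))) := ⟨rfl⟩

instance : IsTopologicalAddGroup (Test t ω) := withSeminorms.topologicalAddGroup
instance : ContinuousSMul ℂ (Test t ω) := withSeminorms.continuousSMul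

theorem fourier_translate (φ : E d → ℂ) (y ξ : E d) :
    ‖𝓕 (fun x => φ (x - y)) ξ‖ = ‖𝓕 φ ξ‖ := by
  have h := congrFun (VectorFourier.fourierIntegral_comp_add_right (W := E d) Real.fourierChar
    volume (innerₗ (E d)) φ (-y)) ξ
  have h' : (fun x => φ (x - y)) = φ ∘ fun v => v + -y := by
    ext x
    simp [sub_eq_add_neg]
  rw [h']
  refine (congrArg norm h).trans ?_
  rw [Circle.norm_smul]
  rfl

/-- The translate `x ↦ φ(x - y)` of a test function. -/
def translate (y : E d) (φ : Test t ω) : Test t ω :=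
  ⟨fun x => φ (x - y), by
    refine ⟨φ.2.1.comp (continuous_id.sub continuous_const), ?_, ?_⟩
    · exact φ.2.2.1.comp_homeomorph (Homeomorph.subRight y)
    · refine UType.quant_mono φ.2.2.2 fun l _ hl => ?_
      simpa only [fnorm, fourier_translate] using hl⟩

/-- The exponential `e_y(x) = e^{2πi y·x}`. -/
def expFun (y : E d) (x : E d) : ℂ := Complex.exp (2 * Real.pi * Complex.I * ⟪y, x⟫)

theorem fourier_modulate (φ : E d → ℂ) (y ξ : E d) :
    𝓕 (fun x => φ x * expFun y x) ξ = 𝓕 φ (ξ - y) := by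
  rw [Real.fourier_eq', Real.fourier_eq']
  congr 1
  ext x
  simp only [expFun, smul_eq_mul, inner_sub_right, real_inner_comm x y]
  rw [mul_comm (φ x), ← mul_assoc, ← Complex.exp_add]
  congr 2
  push_cast
  ring

/-- The product `φ e_y` of a test function with an exponential. -/
def modulate (y : E d) (φ : Test t ω) : Test t ω :=
  ⟨fun x => φ x * expFun y x, by
    refine ⟨φ.2.1.mul (by unfold expFun; fun_prop), φ.2.2.1.mul_right, ?_⟩
    refine UType.quant_mono φ.2.2.2 fun l hl0 hl => ?_
    refine lt_of_le_of_lt (b := fnorm ω l φ * ENNReal.ofReal (Real.exp (l * ω y))) ?_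
      (ENNReal.mul_lt_top hl ENNReal.ofReal_lt_top)
    refine fnorm_le_iff.2 fun ξ => ?_
    rw [fourier_modulate]
    have h1 : ω ξ ≤ ω (ξ - y) + ω y := by simpa using ω.subadd (ξ - y) y
    calc ENNReal.ofReal (‖𝓕 (φ : E d → ℂ) (ξ - y)‖ * Real.exp (l * ω ξ))
        ≤ ENNReal.ofReal (‖𝓕 (φ : E d → ℂ) (ξ - y)‖ * Real.exp (l * ω (ξ - y))
            * Real.exp (l * ω y)) := by
          apply ENNReal.ofReal_le_ofReal
          rw [mul_assoc, ← Real.exp_add, ← mul_add]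
          gcongr
      _ = _ := ENNReal.ofReal_mul (by positivity)
      _ ≤ _ := by
          gcongr
          exact fnorm_le_iff.1 le_rfl (ξ - y)⟩

end Test

/-! ### Ultradistributions -/

/-- The space of ultradistributions `𝓓'_(ω)(ℝᵈ)`, resp. `𝓓'_{ω}(ℝᵈ)`, with the strong dual
topology (uniform convergence on bounded sets of test functions). -/
abbrev Dist (t : UType) (ω : Weight d) : Type := Test t ω →L[ℂ] ℂ

/-- The exponential `e_y` as an ultradistribution: `⟨e_y, φ⟩ = ∫ φ(x) e_y(x) dx`. -/
def expDist (t : UType) (ω : Weight d) (y : E d) : Dist t ω where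
  toFun φ := ∫ x, φ x * Test.expFun y x
  map_add' φ ψ := by
    have hi : ∀ χ : Test t ω, Integrable fun x => χ x * Test.expFun y x :=
      fun χ => (χ.modulate y).integrable
    rw [← integral_add (hi φ) (hi ψ)]
    congr 1
    ext x
    exact add_mul _ _ _
  map_smul' c φ := by
    rw [RingHom.id_apply, smul_eq_mul, ← integral_const_mul]
    congr 1
    ext x
    exact mul_assoc _ _ _
  cont := by
    have key : ∀ φ : Test t ω, ∫ x, φ x * Test.expFun y x = 𝓕 (φ : E d → ℂ) (-y) := by
      intro φ
      rw [Real.fourier_eq']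
      congr 1
      ext x
      rw [mul_comm, smul_eq_mul, Test.expFun]
      congr 2
      rw [inner_neg_right, real_inner_comm]
      push_cast
      ring
    let p : Seminorm ℂ (Test t ω) := Seminorm.of (fun φ => ‖𝓕 (φ : E d → ℂ) (-y)‖)
      (fun φ ψ => by
        refine (congrArg norm (fourier_add' φ.integrable ψ.integrable (-y))).le.trans ?_
        exact norm_add_le _ _)
      (fun c φ => by
        refine (congrArg norm (fourier_smul' c φ (-y))).trans ?_
        exact norm_mul _ _)
    have hp : p ∈ Test.contSeminorms t ω := by
      have h0 : ∀ l : ℝ, 0 < l → ∃ C : ℝ≥0, ∀ φ : Test t ω,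
          ENNReal.ofReal (p φ) ≤ C * fnorm ω l φ := by
        refine fun l hl => ⟨1, fun φ => ?_⟩
        rw [ENNReal.coe_one, one_mul]
        refine le_trans (ENNReal.ofReal_le_ofReal ?_) (fnorm_le_iff.1 le_rfl (-y))
        refine le_mul_of_one_le_right (apply_nonneg p φ) ?_
        exact Real.one_le_exp (mul_nonneg hl.le (ω.nonneg _))
      intro K _
      cases t with
      | beurling => exact ⟨1, one_pos, (h0 1 one_pos).imp fun C hC φ _ => hC φ⟩
      | roumieu => exact fun l hl => (h0 l hl).imp fun C hC φ _ => hC φ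
    let L : Test t ω →ₗ[ℂ] ℂ :=
      { toFun := fun φ => 𝓕 (φ : E d → ℂ) (-y)
        map_add' := fun φ ψ => fourier_add' φ.integrable ψ.integrable (-y)
        map_smul' := fun c φ => fourier_smul' c φ (-y) }
    have hL : Continuous L := by
      refine WithSeminorms.continuous_of_isBounded Test.withSeminorms (norm_withSeminorms ℂ ℂ) L
        fun _ => ⟨{⟨p, hp⟩}, 1, fun φ => ?_⟩
      rw [Finset.sup_singleton, one_smul]
      exact le_rfl
    exact hL.congr fun φ => (key φ).symm

/-- The space of `Λ`-periodic ultradistributions, `f(· + μ) = f` for all `μ ∈ Λ`, with the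
topology induced by the space of all ultradistributions. -/
def periodic (t : UType) (ω : Weight d) (Λ : Submodule ℤ (E d)) : Submodule ℂ (Dist t ω) where
  carrier := {f | ∀ μ ∈ Λ, ∀ φ : Test t ω, f (φ.translate μ) = f φ}
  zero_mem' := fun _ _ _ => rfl
  add_mem' := fun {f g} hf hg μ hμ φ => by
    rw [add_apply, add_apply, hf μ hμ φ, hg μ hμ φ]
  smul_mem' := fun c f hf μ hμ φ => by
    rw [smul_apply, smul_apply, hf μ hμ φ]

/-! ### Lattices and sequence spaces -/

/-- The dual lattice `Λ* = {y : y·x ∈ ℤ for all x ∈ Λ}`. -/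
abbrev dualLattice (Λ : Submodule ℤ (E d)) : Submodule ℤ (E d) :=
  LinearMap.BilinForm.dualSubmodule (innerₗ (E d)) Λ

/-- `∑_{μ ∈ Λ} η(x + μ) = 1` for all `x`. -/
def IsPartitionOfUnity (Λ : Submodule ℤ (E d)) (η : E d → ℂ) : Prop :=
  ∀ x, HasSum (fun μ : Λ => η (x + μ)) 1

/-- The Fourier coefficient `c_y(f) = |Λ|⁻¹ ⟨f, η e_{-y}⟩` of a periodic ultradistribution,
computed with the help of the test function `η`. -/
def fourierCoeff {t : UType} {ω : Weight d} (Λ : Submodule ℤ (E d)) (η : Test t ω)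
    (f : Dist t ω) (y : E d) : ℂ :=
  (ZLattice.covolume Λ : ℂ)⁻¹ * f (η.modulate (-y))

/-- `σ_κ(c) = sup_{μ ∈ M} |c_μ| e^{κ ω(μ)}`, possibly infinite. -/
def snorm (ω : Weight d) (M : Submodule ℤ (E d)) (κ : ℝ) (c : M → ℂ) : ℝ≥0∞ :=
  ⨆ μ : M, ENNReal.ofReal (‖c μ‖ * Real.exp (κ * ω μ))

theorem snorm_add_le (ω : Weight d) (M : Submodule ℤ (E d)) (κ : ℝ) (b c : M → ℂ) :
    snorm ω M κ (b + c) ≤ snorm ω M κ b + snorm ω M κ c := by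
  refine iSup_le fun μ => ?_
  calc ENNReal.ofReal (‖(b + c) μ‖ * Real.exp (κ * ω μ))
      ≤ ENNReal.ofReal (‖b μ‖ * Real.exp (κ * ω μ) + ‖c μ‖ * Real.exp (κ * ω μ)) := by
        apply ENNReal.ofReal_le_ofReal
        rw [← add_mul]
        gcongr
        exact norm_add_le _ _
    _ = _ := ENNReal.ofReal_add (by positivity) (by positivity)
    _ ≤ _ := add_le_add
        (le_iSup (fun μ : M => ENNReal.ofReal (‖b μ‖ * Real.exp (κ * ω μ))) μ)
        (le_iSup (fun μ : M => ENNReal.ofReal (‖c μ‖ * Real.exp (κ * ω μ))) μ)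

theorem snorm_smul_le (ω : Weight d) (M : Submodule ℤ (E d)) (κ : ℝ) (a : ℂ) (c : M → ℂ) :
    snorm ω M κ (a • c) ≤ ENNReal.ofReal ‖a‖ * snorm ω M κ c := by
  refine iSup_le fun μ => ?_
  rw [Pi.smul_apply, smul_eq_mul, norm_mul, mul_assoc, ENNReal.ofReal_mul (norm_nonneg _)]
  gcongr
  exact le_iSup (fun μ : M => ENNReal.ofReal (‖c μ‖ * Real.exp (κ * ω μ))) μ

theorem snorm_zero (ω : Weight d) (M : Submodule ℤ (E d)) (κ : ℝ) :
    snorm ω M κ 0 = 0 := by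
  simp [snorm]

theorem snorm_mono (ω : Weight d) (M : Submodule ℤ (E d)) {κ m : ℝ} (h : κ ≤ m) (c : M → ℂ) :
    snorm ω M κ c ≤ snorm ω M m c := by
  refine iSup_mono fun μ => ENNReal.ofReal_le_ofReal ?_
  have := ω.nonneg (μ : E d)
  gcongr

/-- The sequences `c` on the lattice `M` with `σ_λ(c) < ∞` for all (Beurling), resp. for some
(Roumieu), `λ > 0`. -/
def rapidSubmodule (t : UType) (ω : Weight d) (M : Submodule ℤ (E d)) :
    Submodule ℂ (M → ℂ) where
  carrier := {c | t.quant fun l => snorm ω M l c < ∞}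
  zero_mem' := t.quant_of_forall fun l => by rw [snorm_zero]; exact ENNReal.zero_lt_top
  add_mem' := fun hb hc => UType.quant_and hb hc
    (fun l m h hm => (snorm_mono ω M h _).trans_lt hm)
    (fun l m h hm => (snorm_mono ω M h _).trans_lt hm)
    fun l hl kl => (snorm_add_le ω M l _ _).trans_lt (ENNReal.add_lt_top.2 ⟨hl, kl⟩)
  smul_mem' := fun a c hc => UType.quant_mono hc fun l _ hl =>
    (snorm_smul_le ω M l a c).trans_lt (ENNReal.mul_lt_top ENNReal.ofReal_lt_top hl)

/-- The space `𝓢_(ω)(M)`, resp. `𝓢_{ω}(M)`, of rapidly decreasing sequences on the lattice `M`. -/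
def Rapid (t : UType) (ω : Weight d) (M : Submodule ℤ (E d)) : Type := rapidSubmodule t ω M

namespace Rapid

variable {t : UType} {ω : Weight d} {M : Submodule ℤ (E d)}

instance : AddCommGroup (Rapid t ω M) := inferInstanceAs (AddCommGroup (rapidSubmodule t ω M))
instance : Module ℂ (Rapid t ω M) := inferInstanceAs (Module ℂ (rapidSubmodule t ω M))
instance : CoeFun (Rapid t ω M) (fun _ => M → ℂ) := ⟨fun c => c.1⟩

variable (t ω M) in
/-- The continuous seminorms of the projective limit `𝓢_(ω)(M) = lim_{λ → ∞} 𝓢_ω^λ(M)`, resp. of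
the inductive limit `𝓢_{ω}(M) = lim_{λ → 0+} 𝓢_ω^λ(M)`. -/
def contSeminorms : Set (Seminorm ℂ (Rapid t ω M)) :=
  {p | t.coquant fun l => ∃ C : ℝ≥0, ∀ c : Rapid t ω M,
    ENNReal.ofReal (p c) ≤ C * snorm ω M l c}

/-- The projective (Beurling), resp. locally convex inductive (Roumieu), limit topology. -/
instance : TopologicalSpace (Rapid t ω M) := seminormTopology (contSeminorms t ω M)

end Rapid

/-- The sequences `c` on the lattice `M` with `σ_{-λ}(c) < ∞` for some (Beurling), resp. for all
(Roumieu), `λ > 0`. -/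
def slowSubmodule (t : UType) (ω : Weight d) (M : Submodule ℤ (E d)) :
    Submodule ℂ (M → ℂ) where
  carrier := {c | t.coquant fun l => snorm ω M (-l) c < ∞}
  zero_mem' := t.coquant_of_forall fun l => by rw [snorm_zero]; exact ENNReal.zero_lt_top
  add_mem' := fun {b c} hb hc => by
    have h : ∀ l, snorm ω M (-l) b < ∞ → snorm ω M (-l) c < ∞ → snorm ω M (-l) (b + c) < ∞ :=
      fun l hl kl => (snorm_add_le ω M _ _ _).trans_lt (ENNReal.add_lt_top.2 ⟨hl, kl⟩)
    cases t with
    | beurling =>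
      obtain ⟨l, hl, hbl⟩ := hb
      obtain ⟨m, hm, hcm⟩ := hc
      exact ⟨max l m, lt_max_of_lt_left hl, h _
        ((snorm_mono ω M (neg_le_neg (le_max_left _ _)) _).trans_lt hbl)
        ((snorm_mono ω M (neg_le_neg (le_max_right _ _)) _).trans_lt hcm)⟩
    | roumieu => exact fun l hl => h l (hb l hl) (hc l hl)
  smul_mem' := fun a c hc => by
    have h : ∀ l, snorm ω M (-l) c < ∞ → snorm ω M (-l) (a • c) < ∞ := fun l hl =>
      (snorm_smul_le ω M _ a c).trans_lt (ENNReal.mul_lt_top ENNReal.ofReal_lt_top hl)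
    cases t with
    | beurling => exact ⟨hc.choose, hc.choose_spec.1, h _ hc.choose_spec.2⟩
    | roumieu => exact fun l hl => h l (hc l hl)

/-- The space `𝓢'_(ω)(M) = lim_{λ → ∞} 𝓢_ω^{-λ}(M)`, resp. `𝓢'_{ω}(M) = lim_{λ → 0+} 𝓢_ω^{-λ}(M)`,
of slowly increasing sequences on the lattice `M`. -/
def Slow (t : UType) (ω : Weight d) (M : Submodule ℤ (E d)) : Type := slowSubmodule t ω M

namespace Slow

variable {t : UType} {ω : Weight d} {M : Submodule ℤ (E d)}

instance : AddCommGroup (Slow t ω M) := inferInstanceAs (AddCommGroup (slowSubmodule t ω M))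
instance : Module ℂ (Slow t ω M) := inferInstanceAs (Module ℂ (slowSubmodule t ω M))
instance : CoeFun (Slow t ω M) (fun _ => M → ℂ) := ⟨fun c => c.1⟩

variable (t ω M) in
/-- The continuous seminorms of the inductive limit `lim_{λ → ∞} 𝓢_ω^{-λ}(M)` (Beurling), resp. of
the projective limit `lim_{λ → 0+} 𝓢_ω^{-λ}(M)` (Roumieu). -/
def contSeminorms : Set (Seminorm ℂ (Slow t ω M)) :=
  {p | t.quant fun l => ∃ C : ℝ≥0, ∀ c : Slow t ω M,
    ENNReal.ofReal (p c) ≤ C * snorm ω M (-l) c}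

/-- The locally convex inductive (Beurling), resp. projective (Roumieu), limit topology. -/
instance : TopologicalSpace (Slow t ω M) := seminormTopology (contSeminorms t ω M)

end Slow

end Ultra

end

/-! The theorem is a statement about test functions, transposed. Sampling the Fourier transform on
`dualLattice Λ` gives a continuous map `Test.coeff` from test functions φ to rapidly decreasing
sequences (∫ φ e_ν). Conversely, if η is a Beurling partition of unity, s ↦ |Λ|⁻¹ η ∑ s_ν e_{-ν} is
a continuous map `Rapid.toTest` back, and `Test.coeff` after `Rapid.toTest` is the identity
(`coeff_toTest`). A test function killed by `Test.coeff` has zero periodization, because the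
characters are complete on the torus (`periodization_eq_zero`), and a periodic f vanishes on such
functions (`apply_eq_zero_of_periodization`). Hence f = f ∘ `Rapid.toTest` ∘ `Test.coeff` for
periodic f, and the two transposes identify the periodic ultradistributions with the strong dual of
the rapidly decreasing sequences (`periodicEquiv`).

That dual is the space of slowly increasing sequences (`pairingEquiv`). For the topologies, bounded
sets of rapidly decreasing sequences are exactly those dominated by a single such sequence, and the
seminorms c ↦ ∑ |c_μ| |b_μ| determine the topology of the slow sequences. Both rest on the
summability of e^{-kω} over the lattice, for some k by (γ) and for all k by (γ₀); every estimate
spends a piece k of the exponent on this sum.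

The coefficients do not depend on the partition χ since `Test.coeff` sends χ e_{-μ} to |Λ| δ_μ. The
Fourier series is the image of the unconditional expansion c = ∑ c_μ δ_μ under a continuous linear
map with δ_μ ↦ e_μ.

A Beurling partition of unity exists by (β). Subadditivity turns the integral condition into bounds
W_j of ω on |ξ| ≤ 8ʲ with ∑ 8⁻ʲ W_j < ∞. Averaging a bump about κ_j W_j times over segments of
length comparable to 8⁻ʲ, with κ_j → ∞ slowly, produces a compactly supported kernel whose transform
decays faster than every e^{-λω}. Its convolution with the indicator of a fundamental domain is the
partition. -/

noncomputable section

namespace Ultra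

variable {d : ℕ}

/-! ### The quantifiers over `λ` -/

namespace UType

variable {t : UType} {P Q R : ℝ → Prop}

theorem coquant_mono (hP : t.coquant P) (h : ∀ l, 0 < l → P l → Q l) : t.coquant Q := by
  cases t with
  | beurling =>
    obtain ⟨l, hl, hPl⟩ := hP
    exact ⟨l, hl, h l hl hPl⟩
  | roumieu => exact fun l hl => h l hl (hP l hl)

theorem coquant_and (hP : t.coquant P) (hQ : t.coquant Q)
    (mP : ∀ l m, l ≤ m → P l → P m) (mQ : ∀ l m, l ≤ m → Q l → Q m)
    (h : ∀ l, P l → Q l → R l) : t.coquant R := by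
  cases t with
  | beurling =>
    obtain ⟨l, hl, hPl⟩ := hP
    obtain ⟨m, hm, hQm⟩ := hQ
    exact ⟨max l m, lt_max_of_lt_left hl, h _ (mP _ _ (le_max_left _ _) hPl)
      (mQ _ _ (le_max_right _ _) hQm)⟩
  | roumieu => exact fun l hl => h l (hP l hl) (hQ l hl)

/-- The budget rule for exponents. In the Beurling case P holds at every exponent, so the needs of Q
and R are added; in the Roumieu case the single exponent of P is halved, as Q and R hold at every
exponent. This treats both types by one argument below. -/
theorem exists_split (hP : t.quant P) (hQ : t.coquant Q) (hR : t.coquant R) :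
    ∃ l k, 0 < l ∧ 0 < k ∧ P (l + k) ∧ Q l ∧ R k := by
  cases t with
  | beurling =>
    obtain ⟨l, hl, hQl⟩ := hQ
    obtain ⟨k, hk, hRk⟩ := hR
    exact ⟨l, k, hl, hk, hP _ (by positivity), hQl, hRk⟩
  | roumieu =>
    obtain ⟨m, hm, hPm⟩ := hP
    exact ⟨m / 2, m / 2, by positivity, by positivity, by rwa [add_halves], hQ _ (by positivity),
      hR _ (by positivity)⟩

theorem coquant_add (hP : t.coquant P) (hQ : t.coquant Q)
    (h : ∀ l k, 0 < l → 0 < k → P l → Q k → R (l + k)) : t.coquant R := by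
  cases t with
  | beurling =>
    obtain ⟨l, hl, hPl⟩ := hP
    obtain ⟨k, hk, hQk⟩ := hQ
    exact ⟨l + k, by positivity, h l k hl hk hPl hQk⟩
  | roumieu =>
    intro m hm
    have := h (m / 2) (m / 2) (by positivity) (by positivity) (hP _ (by positivity))
      (hQ _ (by positivity))
    rwa [add_halves] at this

theorem quant_sub (hP : t.quant P) (hQ : t.coquant Q)
    (h : ∀ l k, 0 < l → 0 < k → P (l + k) → Q k → R l) : t.quant R := by
  cases t with
  | beurling =>
    obtain ⟨k, hk, hQk⟩ := hQ
    exact fun l hl => h l k hl hk (hP _ (by positivity)) hQk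
  | roumieu =>
    obtain ⟨m, hm, hPm⟩ := hP
    exact ⟨m / 2, by positivity, h (m / 2) (m / 2) (by positivity) (by positivity)
      (by rwa [add_halves]) (hQ _ (by positivity))⟩

end UType

/-! ### Topologies generated by all continuous seminorms -/

/-- For N = ∞ the right side must be infinite, and 0 * ∞ = 0 rules out C = 0. This is why constants
are enlarged by 1 later on. -/
theorem ofReal_le_mul_of_toReal {x : ℝ} {C : ℝ≥0} (hC : 0 < C) {N : ℝ≥0∞}
    (h : N < ∞ → x ≤ C * N.toReal) : ENNReal.ofReal x ≤ C * N := by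
  rcases eq_or_ne N ∞ with rfl | hN
  · rw [ENNReal.mul_top (by exact_mod_cast hC.ne')]
    exact le_top
  · refine ENNReal.ofReal_le_of_le_toReal ?_
    rw [ENNReal.toReal_mul]
    exact h hN.lt_top

theorem le_mul_toReal_of_ofReal_le {x : ℝ} {C : ℝ≥0} {N : ℝ≥0∞} (hN : N < ∞)
    (h : ENNReal.ofReal x ≤ C * N) : x ≤ C * N.toReal := by
  have := (ENNReal.ofReal_le_iff_le_toReal
    (ENNReal.mul_ne_top ENNReal.coe_ne_top hN.ne)).1 h
  rwa [ENNReal.toReal_mul] at this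

/-- A seminorm that is continuous for the topology generated by a set `S` of seminorms belongs
to `S`, provided that `S` is saturated. -/
theorem mem_of_continuous_seminorm {V : Type*} [AddCommGroup V] [Module ℂ V] [TopologicalSpace V]
    {S : Set (Seminorm ℂ V)} [Nonempty S] (hS : WithSeminorms (fun p : S => (p : Seminorm ℂ V)))
    (h0 : (0 : Seminorm ℂ V) ∈ S) (hsup : ∀ p ∈ S, ∀ q ∈ S, p ⊔ q ∈ S)
    (hsmul : ∀ (C : ℝ≥0), ∀ p ∈ S, C • p ∈ S) (hle : ∀ p ∈ S, ∀ q, q ≤ p → q ∈ S)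
    {q : Seminorm ℂ V} (hq : Continuous q) : q ∈ S := by
  obtain ⟨s, C, -, hC⟩ := Seminorm.bound_of_continuous hS q hq
  refine hle _ (hsmul C _ ?_) q hC
  refine Finset.sup_induction (p := fun r => r ∈ S) h0 hsup fun p _ => p.2

/-! ### Weighted sequence spaces and expansions in unit sequences -/

variable {t : UType} {ω : Weight d} {M : Submodule ℤ (E d)}

theorem mul_exp_le_snorm {κ : ℝ} {c : M → ℂ} (h : snorm ω M κ c < ∞) (μ : M) :
    ‖c μ‖ * Real.exp (κ * ω μ) ≤ (snorm ω M κ c).toReal := by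
  refine (ENNReal.ofReal_le_iff_le_toReal h.ne).1 ?_
  exact le_iSup (fun μ : M => ENNReal.ofReal (‖c μ‖ * Real.exp (κ * ω μ))) μ

theorem norm_le_snorm {κ : ℝ} {c : M → ℂ} (h : snorm ω M κ c < ∞) (μ : M) :
    ‖c μ‖ ≤ (snorm ω M κ c).toReal * Real.exp (-(κ * ω μ)) := by
  rw [Real.exp_neg, ← div_eq_mul_inv, le_div_iff₀ (Real.exp_pos _)]
  exact mul_exp_le_snorm h μ

theorem snorm_le_ofReal {κ A : ℝ} {c : M → ℂ}
    (h : ∀ μ, ‖c μ‖ * Real.exp (κ * ω μ) ≤ A) : snorm ω M κ c ≤ ENNReal.ofReal A :=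
  iSup_le fun μ => ENNReal.ofReal_le_ofReal (h μ)

theorem snorm_le_of_norm_le {κ : ℝ} {b c : M → ℂ} (h : ∀ μ, ‖b μ‖ ≤ ‖c μ‖) :
    snorm ω M κ b ≤ snorm ω M κ c := by
  refine iSup_mono fun μ => ENNReal.ofReal_le_ofReal ?_
  gcongr
  exact h μ

/-- The unit sequence `δ_μ`. -/
def unitSeq (μ : M) : M → ℂ := Set.indicator {μ} 1

theorem unitSeq_self (μ : M) : unitSeq μ μ = 1 := by simp [unitSeq]

theorem unitSeq_of_ne {μ ν : M} (h : ν ≠ μ) : unitSeq μ ν = 0 := by simp [unitSeq, h]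

theorem snorm_unitSeq (κ : ℝ) (μ : M) :
    snorm ω M κ (unitSeq μ) = ENNReal.ofReal (Real.exp (κ * ω μ)) := by
  refine le_antisymm (iSup_le fun ν => ?_) ?_
  · by_cases h : ν = μ
    · subst h
      simp [unitSeq_self]
    · simp [unitSeq_of_ne h]
  · refine le_trans (le_of_eq ?_)
      (le_iSup (fun ν : M => ENNReal.ofReal (‖unitSeq μ ν‖ * Real.exp (κ * ω ν))) μ)
    simp [unitSeq_self]

theorem sum_smul_unitSeq (c : M → ℂ) (F : Finset M) (ν : M) [Decidable (ν ∈ F)] :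
    (∑ μ ∈ F, c μ • unitSeq μ) ν = if ν ∈ F then c ν else 0 := by
  classical
  rw [Finset.sum_apply]
  split_ifs with h
  · rw [Finset.sum_eq_single_of_mem ν h]
    · simp [unitSeq_self]
    · intro μ _ hμ
      simp [unitSeq_of_ne hμ.symm]
  · refine Finset.sum_eq_zero fun μ hμ => ?_
    have : ν ≠ μ := by
      rintro rfl
      exact h hμ
    simp [unitSeq_of_ne this]

/-- The surplus exponent k buys smallness: off a finite set e^{-kω} is below ε/(A+1), and there the
weighted term is at most A times that. -/
theorem eventually_snorm_tail_le {κ k : ℝ} {c : M → ℂ} (hc : snorm ω M (κ + k) c < ∞)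
    (hk : Summable fun μ : M => Real.exp (-(k * ω μ))) {ε : ℝ} (hε : 0 < ε) :
    ∀ᶠ F : Finset M in atTop, snorm ω M κ (∑ μ ∈ F, c μ • unitSeq μ - c) ≤ ENNReal.ofReal ε := by
  classical
  set A := (snorm ω M (κ + k) c).toReal with hA
  have hA0 : 0 ≤ A := ENNReal.toReal_nonneg
  have h1 : ∀ᶠ μ : M in cofinite, Real.exp (-(k * ω μ)) < ε / (A + 1) :=
    hk.tendsto_cofinite_zero.eventually (gt_mem_nhds (by positivity))
  have hfin : {μ : M | ¬ Real.exp (-(k * ω μ)) < ε / (A + 1)}.Finite := h1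
  filter_upwards [eventually_ge_atTop hfin.toFinset] with F hF
  refine snorm_le_ofReal fun ν => ?_
  rw [Pi.sub_apply, sum_smul_unitSeq]
  split_ifs with hν
  · simpa using hε.le
  · have h2 : Real.exp (-(k * ω ν)) < ε / (A + 1) := by
      by_contra h
      exact hν (hF (by simpa using h))
    rw [zero_sub, norm_neg]
    calc ‖c ν‖ * Real.exp (κ * ω ν)
        = ‖c ν‖ * Real.exp ((κ + k) * ω ν) * Real.exp (-(k * ω ν)) := by
          rw [mul_assoc, ← Real.exp_add]
          ring_nf
      _ ≤ A * (ε / (A + 1)) := by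
          gcongr
          exact mul_exp_le_snorm hc ν
      _ ≤ ε := by
          rw [mul_div_assoc', div_le_iff₀ (by positivity)]
          nlinarith

namespace Rapid

theorem withSeminorms :
    WithSeminorms (fun p : contSeminorms t ω M => (p : Seminorm ℂ (Rapid t ω M))) := ⟨rfl⟩

theorem zero_mem_contSeminorms : (0 : Seminorm ℂ (Rapid t ω M)) ∈ contSeminorms t ω M :=
  t.coquant_of_forall fun _ => ⟨0, fun _ => by simp⟩

instance : Nonempty (contSeminorms t ω M) := ⟨⟨0, zero_mem_contSeminorms⟩⟩

instance : IsTopologicalAddGroup (Rapid t ω M) := withSeminorms.topologicalAddGroup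
instance : ContinuousSMul ℂ (Rapid t ω M) := withSeminorms.continuousSMul

/-- The defining family is saturated, so continuity of a seminorm yields an actual estimate by some
(Beurling) or every (Roumieu) weighted norm. -/
theorem mem_contSeminorms_of_continuous {q : Seminorm ℂ (Rapid t ω M)} (hq : Continuous q) :
    q ∈ contSeminorms t ω M := by
  refine mem_of_continuous_seminorm withSeminorms zero_mem_contSeminorms ?_ ?_ ?_ hq
  · intro p hp q hq
    have mono : ∀ r : Seminorm ℂ (Rapid t ω M), ∀ l m : ℝ, l ≤ m →
        (∃ C : ℝ≥0, ∀ c : Rapid t ω M, ENNReal.ofReal (r c) ≤ C * snorm ω M l c) →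
        ∃ C : ℝ≥0, ∀ c : Rapid t ω M, ENNReal.ofReal (r c) ≤ C * snorm ω M m c := by
      rintro r l m h ⟨C, hC⟩
      exact ⟨C, fun c => (hC c).trans (by gcongr; exact snorm_mono ω M h _)⟩
    refine UType.coquant_and hp hq (mono p) (mono q) ?_
    rintro l ⟨C, hC⟩ ⟨D, hD⟩
    refine ⟨max C D, fun c => ?_⟩
    rw [Seminorm.sup_apply, ENNReal.ofReal_max]
    refine max_le ((hC c).trans ?_) ((hD c).trans ?_)
    · gcongr
      exact le_max_left _ _
    · gcongr
      exact le_max_right _ _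
  · intro C p hp
    refine UType.coquant_mono hp ?_
    rintro l - ⟨D, hD⟩
    refine ⟨C * D, fun c => ?_⟩
    rw [_root_.smul_apply, NNReal.smul_def, smul_eq_mul, ENNReal.ofReal_mul C.coe_nonneg,
      ENNReal.ofReal_coe_nnreal, ENNReal.coe_mul, mul_assoc]
    gcongr
    exact hD c
  · intro p hp q hqp
    refine UType.coquant_mono hp ?_
    rintro l - ⟨D, hD⟩
    exact ⟨D, fun c => (ENNReal.ofReal_le_ofReal (hqp c)).trans (hD c)⟩

/-- The unit sequence `δ_μ` as an element of `𝓢`. -/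
def unit (μ : M) : Rapid t ω M :=
  ⟨unitSeq μ, t.quant_of_forall fun l => by rw [snorm_unitSeq]; exact ENNReal.ofReal_lt_top⟩

/-- The inclusion into the space of all sequences. -/
def coeₗ : Rapid t ω M →ₗ[ℂ] (M → ℂ) where
  toFun c := c
  map_add' _ _ := rfl
  map_smul' _ _ := rfl

theorem coe_sum_smul_unit (s : Rapid t ω M) (F : Finset M) :
    ((∑ μ ∈ F, s μ • unit μ : Rapid t ω M) - s : Rapid t ω M).1 =
      ∑ μ ∈ F, s μ • unitSeq μ - s.1 := by
  change coeₗ (_ - _) = _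
  rw [map_sub, map_sum]
  rfl

theorem hasSum_unit (hM : t.coquant fun k => Summable fun μ : M => Real.exp (-(k * ω μ)))
    (s : Rapid t ω M) : HasSum (fun μ => s μ • unit μ) s := by
  refine (withSeminorms.tendsto_nhds _ _).2 ?_
  rintro ⟨p, hp⟩ ε hε
  -- The seminorm is controlled at exponent l, while s is bounded at l + k; the difference k makes
  -- the tails small.
  obtain ⟨l, k, -, -, hs, ⟨C, hC⟩, hk⟩ := UType.exists_split s.2 hp hM
  have hε' : 0 < ε / (C + 1) := by positivity
  filter_upwards [eventually_snorm_tail_le hs hk hε'] with F hF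
  have h1 := hC ((∑ μ ∈ F, s μ • unit μ) - s)
  rw [coe_sum_smul_unit] at h1
  have h2 := le_mul_toReal_of_ofReal_le (hF.trans_lt ENNReal.ofReal_lt_top) h1
  have h3 := ENNReal.toReal_le_of_le_ofReal hε'.le hF
  refine (h2.trans (mul_le_mul_of_nonneg_left h3 C.coe_nonneg)).trans_lt ?_
  rw [mul_div_assoc', div_lt_iff₀ (by positivity)]
  nlinarith

end Rapid

namespace Slow

theorem withSeminorms :
    WithSeminorms (fun p : contSeminorms t ω M => (p : Seminorm ℂ (Slow t ω M))) := ⟨rfl⟩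

instance : Nonempty (contSeminorms t ω M) :=
  ⟨⟨0, t.quant_of_forall fun _ => ⟨0, fun _ => by simp⟩⟩⟩

instance : IsTopologicalAddGroup (Slow t ω M) := withSeminorms.topologicalAddGroup
instance : ContinuousSMul ℂ (Slow t ω M) := withSeminorms.continuousSMul

/-- The unit sequence `δ_μ` as an element of `𝓢'`. -/
def unit (μ : M) : Slow t ω M :=
  ⟨unitSeq μ, t.coquant_of_forall fun l => by rw [snorm_unitSeq]; exact ENNReal.ofReal_lt_top⟩

/-- The inclusion into the space of all sequences. -/
def coeₗ : Slow t ω M →ₗ[ℂ] (M → ℂ) where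
  toFun c := c
  map_add' _ _ := rfl
  map_smul' _ _ := rfl

theorem coe_sum_smul_unit (s : Slow t ω M) (F : Finset M) :
    ((∑ μ ∈ F, s μ • unit μ : Slow t ω M) - s : Slow t ω M).1 =
      ∑ μ ∈ F, s μ • unitSeq μ - s.1 := by
  change coeₗ (_ - _) = _
  rw [map_sub, map_sum]
  rfl

theorem hasSum_unit (hM : t.coquant fun k => Summable fun μ : M => Real.exp (-(k * ω μ)))
    (c : Slow t ω M) : HasSum (fun μ => c μ • unit μ) c := by
  refine (withSeminorms.tendsto_nhds _ _).2 ?_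
  rintro ⟨p, hp⟩ ε hε
  -- Roles are exchanged here: c is bounded at -l and the seminorm is controlled at -(l + k).
  obtain ⟨l, k, -, -, ⟨C, hC⟩, hc, hk⟩ := UType.exists_split hp c.2 hM
  have hε' : 0 < ε / (C + 1) := by positivity
  have hc' : snorm ω M (-(l + k) + k) c < ∞ := by rwa [neg_add, neg_add_cancel_right]
  filter_upwards [eventually_snorm_tail_le hc' hk hε'] with F hF
  have h1 := hC ((∑ μ ∈ F, c μ • unit μ) - c)
  rw [coe_sum_smul_unit] at h1
  have h2 := le_mul_toReal_of_ofReal_le (hF.trans_lt ENNReal.ofReal_lt_top) h1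
  have h3 := ENNReal.toReal_le_of_le_ofReal hε'.le hF
  refine (h2.trans (mul_le_mul_of_nonneg_left h3 C.coe_nonneg)).trans_lt ?_
  rw [mul_div_assoc', div_lt_iff₀ (by positivity)]
  nlinarith

end Slow

/-! ### The duality of `𝓢` and `𝓢'` -/

theorem norm_mul_le_of_snorm {l k : ℝ} {c s : M → ℂ} (hc : snorm ω M (-l) c < ∞)
    (hs : snorm ω M (l + k) s < ∞) (μ : M) :
    ‖c μ‖ * ‖s μ‖ ≤ (snorm ω M (-l) c).toReal * (snorm ω M (l + k) s).toReal *
      Real.exp (-(k * ω μ)) := by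
  calc ‖c μ‖ * ‖s μ‖ ≤ ((snorm ω M (-l) c).toReal * Real.exp (-(-l * ω μ))) *
        ((snorm ω M (l + k) s).toReal * Real.exp (-((l + k) * ω μ))) := by
        gcongr
        · exact norm_le_snorm hc μ
        · exact norm_le_snorm hs μ
    _ = _ := by
        rw [mul_mul_mul_comm, ← Real.exp_add]
        ring_nf

theorem summable_norm_mul_norm
    (hM : t.coquant fun k => Summable fun μ : M => Real.exp (-(k * ω μ)))
    {c s : M → ℂ} (hc : t.coquant fun l => snorm ω M (-l) c < ∞)
    (hs : t.quant fun l => snorm ω M l s < ∞) : Summable fun μ => ‖c μ‖ * ‖s μ‖ := by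
  obtain ⟨l, k, -, -, hs, hc, hk⟩ := UType.exists_split hs hc hM
  exact Summable.of_nonneg_of_le (fun μ => by positivity) (norm_mul_le_of_snorm hc hs)
    (hk.mul_left _)

theorem tsum_norm_mul_norm_le {l k : ℝ} {c s : M → ℂ} (hc : snorm ω M (-l) c < ∞)
    (hs : snorm ω M (l + k) s < ∞) (hk : Summable fun μ : M => Real.exp (-(k * ω μ))) :
    ∑' μ, ‖c μ‖ * ‖s μ‖ ≤ (snorm ω M (-l) c).toReal * (snorm ω M (l + k) s).toReal *
      ∑' μ : M, Real.exp (-(k * ω μ)) := by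
  rw [← tsum_mul_left]
  exact Summable.tsum_le_tsum (norm_mul_le_of_snorm hc hs)
    (Summable.of_nonneg_of_le (fun μ => by positivity) (norm_mul_le_of_snorm hc hs)
    (hk.mul_left _)) (hk.mul_left _)

/-- The continuous seminorm `s ↦ ∑ |c_μ| |s_μ|` on `𝓢` defined by `c ∈ 𝓢'`. -/
def Rapid.absPairing (hM : t.coquant fun k => Summable fun μ : M => Real.exp (-(k * ω μ)))
    (c : Slow t ω M) : Seminorm ℂ (Rapid t ω M) :=
  Seminorm.of (fun s => ∑' μ, ‖c μ‖ * ‖s μ‖)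
    (fun r s => by
      have hr := summable_norm_mul_norm hM c.2 r.2
      have hs := summable_norm_mul_norm hM c.2 s.2
      rw [← hr.tsum_add hs]
      refine (summable_norm_mul_norm hM c.2 (r + s).2).tsum_le_tsum (fun μ => ?_) (hr.add hs)
      rw [← mul_add]
      exact mul_le_mul_of_nonneg_left (norm_add_le (r μ) (s μ)) (norm_nonneg _))
    (fun a s => by
      rw [← tsum_mul_left]
      refine tsum_congr fun μ => ?_
      rw [mul_left_comm]
      exact congrArg (‖c μ‖ * ·) (norm_mul a (s μ)))

theorem Rapid.absPairing_mem (hM : t.coquant fun k => Summable fun μ : M => Real.exp (-(k * ω μ)))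
    (c : Slow t ω M) : Rapid.absPairing hM c ∈ Rapid.contSeminorms t ω M := by
  refine UType.coquant_add c.2 hM fun l k _ _ hc hk => ?_
  set A := (snorm ω M (-l) c).toReal * ∑' μ : M, Real.exp (-(k * ω μ))
  have hA : 0 ≤ A := mul_nonneg ENNReal.toReal_nonneg (tsum_nonneg fun _ => (Real.exp_pos _).le)
  refine ⟨⟨A + 1, by positivity⟩, fun s => ofReal_le_mul_of_toReal ?_ fun hs => ?_⟩
  · exact (by positivity : 0 < A + 1)
  · refine (tsum_norm_mul_norm_le hc hs hk).trans ?_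
    rw [mul_right_comm]
    exact mul_le_mul_of_nonneg_right (le_add_of_nonneg_right zero_le_one)
      ENNReal.toReal_nonneg

/-- The continuous seminorm `c ↦ ∑ |c_μ| |s_μ|` on `𝓢'` defined by `s ∈ 𝓢`. -/
def Slow.absPairing (hM : t.coquant fun k => Summable fun μ : M => Real.exp (-(k * ω μ)))
    (s : Rapid t ω M) : Seminorm ℂ (Slow t ω M) :=
  Seminorm.of (fun c => ∑' μ, ‖c μ‖ * ‖s μ‖)
    (fun b c => by
      have hb := summable_norm_mul_norm hM b.2 s.2
      have hc := summable_norm_mul_norm hM c.2 s.2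
      rw [← hb.tsum_add hc]
      refine (summable_norm_mul_norm hM (b + c).2 s.2).tsum_le_tsum (fun μ => ?_) (hb.add hc)
      rw [← add_mul]
      exact mul_le_mul_of_nonneg_right (norm_add_le (b μ) (c μ)) (norm_nonneg _))
    (fun a c => by
      rw [← tsum_mul_left]
      refine tsum_congr fun μ => ?_
      rw [← mul_assoc]
      exact congrArg (· * ‖s μ‖) (norm_mul a (c μ)))

theorem Slow.absPairing_mem (hM : t.coquant fun k => Summable fun μ : M => Real.exp (-(k * ω μ)))
    (s : Rapid t ω M) : Slow.absPairing hM s ∈ Slow.contSeminorms t ω M := by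
  refine UType.quant_sub s.2 hM fun l k _ _ hs hk => ?_
  set A := (snorm ω M (l + k) s).toReal * ∑' μ : M, Real.exp (-(k * ω μ))
  have hA : 0 ≤ A := mul_nonneg ENNReal.toReal_nonneg (tsum_nonneg fun _ => (Real.exp_pos _).le)
  refine ⟨⟨A + 1, by positivity⟩, fun c => ofReal_le_mul_of_toReal ?_ fun hc => ?_⟩
  · exact (by positivity : 0 < A + 1)
  · refine (tsum_norm_mul_norm_le hc hs hk).trans ?_
    rw [mul_assoc, mul_comm]
    exact mul_le_mul_of_nonneg_right (le_add_of_nonneg_right zero_le_one)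
      ENNReal.toReal_nonneg

theorem summable_mul (hM : t.coquant fun k => Summable fun μ : M => Real.exp (-(k * ω μ)))
    (c : Slow t ω M) (s : Rapid t ω M) : Summable fun μ => c μ * s μ :=
  Summable.of_norm (by simpa only [norm_mul] using summable_norm_mul_norm hM c.2 s.2)

/-- The linear functional `s ↦ ∑ c_μ s_μ` on `𝓢` defined by `c ∈ 𝓢'`. -/
def pairingₗ (hM : t.coquant fun k => Summable fun μ : M => Real.exp (-(k * ω μ)))
    (c : Slow t ω M) : Rapid t ω M →ₗ[ℂ] ℂ where
  toFun s := ∑' μ, c μ * s μ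
  map_add' r s := by
    rw [← (summable_mul hM c r).tsum_add (summable_mul hM c s)]
    exact tsum_congr fun μ => mul_add _ _ _
  map_smul' a s := by
    rw [RingHom.id_apply, smul_eq_mul, ← tsum_mul_left]
    exact tsum_congr fun μ => mul_left_comm _ _ _

theorem norm_pairingₗ_le (hM : t.coquant fun k => Summable fun μ : M => Real.exp (-(k * ω μ)))
    (c : Slow t ω M) (s : Rapid t ω M) : ‖pairingₗ hM c s‖ ≤ ∑' μ, ‖c μ‖ * ‖s μ‖ := by
  have h := summable_norm_mul_norm hM c.2 s.2
  simp_rw [← norm_mul] at h ⊢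
  exact norm_tsum_le_tsum_norm h

/-- The continuous linear functional `s ↦ ∑ c_μ s_μ` on `𝓢` defined by `c ∈ 𝓢'`. -/
def pairing (hM : t.coquant fun k => Summable fun μ : M => Real.exp (-(k * ω μ)))
    (c : Slow t ω M) : Rapid t ω M →L[ℂ] ℂ where
  toLinearMap := pairingₗ hM c
  cont := by
    refine WithSeminorms.continuous_of_isBounded Rapid.withSeminorms (norm_withSeminorms ℂ ℂ)
      (pairingₗ hM c) fun _ => ⟨{⟨_, Rapid.absPairing_mem hM c⟩}, 1, fun s => ?_⟩
    rw [Finset.sup_singleton, one_smul]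
    exact norm_pairingₗ_le hM c s

theorem hasSum_pairing (hM : t.coquant fun k => Summable fun μ : M => Real.exp (-(k * ω μ)))
    (c : Slow t ω M) (s : Rapid t ω M) : HasSum (fun μ => c μ * s μ) (pairing hM c s) :=
  (summable_mul hM c s).hasSum

theorem pairing_unit (hM : t.coquant fun k => Summable fun μ : M => Real.exp (-(k * ω μ)))
    (c : Slow t ω M) (μ : M) : pairing hM c (Rapid.unit μ) = c μ := by
  refine (hasSum_pairing hM c _).unique ?_
  convert! hasSum_single μ fun ν hν => ?_
  · exact (mul_one (c μ)).symm.trans (congrArg (c μ * ·) (unitSeq_self μ).symm)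
  · exact (congrArg (c ν * ·) (unitSeq_of_ne hν)).trans (mul_zero _)

theorem pairing_unit_left (hM : t.coquant fun k => Summable fun μ : M => Real.exp (-(k * ω μ)))
    (μ : M) (s : Rapid t ω M) : pairing hM (Slow.unit μ) s = s μ := by
  refine (hasSum_pairing hM _ s).unique ?_
  convert! hasSum_single μ fun ν hν => ?_
  · exact (one_mul (s μ)).symm.trans (congrArg (· * s μ) (unitSeq_self μ).symm)
  · exact (congrArg (· * s ν) (unitSeq_of_ne hν)).trans (zero_mul _)

/-- The coefficients `g(δ_μ)` of a continuous linear functional `g` on `𝓢`. -/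
def coeffSeq (g : Rapid t ω M →L[ℂ] ℂ) : Slow t ω M :=
  ⟨fun μ => g (Rapid.unit μ), by
    -- The continuous seminorm |g| is bounded by C times the l-norm; evaluated at δ_μ this gives
    -- |g(δ_μ)| ≤ C e^{lω(μ)}.
    have hp : (normSeminorm ℂ ℂ).comp (g : Rapid t ω M →ₗ[ℂ] ℂ) ∈ Rapid.contSeminorms t ω M :=
      Rapid.mem_contSeminorms_of_continuous g.continuous.norm
    refine UType.coquant_mono hp ?_
    rintro l - ⟨C, hC⟩
    refine (snorm_le_ofReal (A := C) fun μ => ?_).trans_lt ENNReal.ofReal_lt_top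
    have h1 := hC (Rapid.unit μ)
    have h2 : snorm ω M l (Rapid.unit μ : Rapid t ω M) = _ := snorm_unitSeq l μ
    rw [h2] at h1
    have h3 := le_mul_toReal_of_ofReal_le ENNReal.ofReal_lt_top h1
    rw [ENNReal.toReal_ofReal (Real.exp_pos _).le] at h3
    have h4 : ‖g (Rapid.unit μ)‖ ≤ C * Real.exp (l * ω μ) := h3
    rw [neg_mul, Real.exp_neg, ← div_eq_mul_inv, div_le_iff₀ (Real.exp_pos _)]
    exact h4⟩

theorem pairing_coeffSeq (hM : t.coquant fun k => Summable fun μ : M => Real.exp (-(k * ω μ)))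
    (g : Rapid t ω M →L[ℂ] ℂ) : pairing hM (coeffSeq g) = g := by
  ext s
  have h := (Rapid.hasSum_unit hM s).mapL g
  refine (hasSum_pairing hM _ s).unique (h.congr_fun fun μ => ?_)
  rw [map_smul, smul_eq_mul, mul_comm]
  rfl

theorem coeffSeq_pairing (hM : t.coquant fun k => Summable fun μ : M => Real.exp (-(k * ω μ)))
    (c : Slow t ω M) : coeffSeq (pairing hM c) = c :=
  Subtype.ext (funext fun μ => pairing_unit hM c μ)

/-- For the Roumieu type this is regularity of the inductive limit: a bounded set is bounded in a
single step. Only the seminorms s ↦ ∑ |c_μ| |s_μ| are tested, with a slow sequence c made for the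
purpose. -/
theorem Rapid.quant_bounded
    (hM : t.coquant fun k => Summable fun μ : M => Real.exp (-(k * ω μ)))
    {B : Set (Rapid t ω M)} (hB : Bornology.IsVonNBounded ℂ B) :
    t.quant fun l => ∃ A, ∀ s ∈ B, ∀ μ, ‖s μ‖ * Real.exp (l * ω μ) ≤ A := by
  have hbd : ∀ c : Slow t ω M, ∃ A, ∀ s ∈ B, ∀ μ, ‖c μ‖ * ‖s μ‖ ≤ A := by
    intro c
    obtain ⟨r, -, hr⟩ := Rapid.withSeminorms.isVonNBounded_iff_seminorm_bounded.1 hB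
      ⟨_, Rapid.absPairing_mem hM c⟩
    refine ⟨r, fun s hs μ => le_trans ?_ (hr s hs).le⟩
    exact (summable_norm_mul_norm hM c.2 s.2).le_tsum μ fun ν _ => by positivity
  cases t with
  | beurling =>
    intro l hl
    -- For the Beurling type the weight e^{lω} is itself a slow sequence, so it can be used as c.
    obtain ⟨A, hA⟩ := hbd ⟨fun μ => (Real.exp (l * ω μ) : ℝ), l, hl, by
      refine (snorm_le_ofReal (A := 1) fun μ => ?_).trans_lt ENNReal.ofReal_lt_top
      rw [Complex.norm_real, Real.norm_eq_abs, Real.abs_exp, ← Real.exp_add]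
      simp⟩
    refine ⟨A, fun s hs μ => (le_of_eq ?_).trans (hA s hs μ)⟩
    simp only [Complex.norm_real, Real.norm_eq_abs, Real.abs_exp]
    ring
  | roumieu =>
    -- If B is bounded in no step, then for each n the exponent 1/(n+1) with bound n fails at some
    -- point ν n for some s n in B. These violations are packed into one slow sequence.
    by_contra hcon
    have hcon' : ∀ n : ℕ, ∃ μ : M, ∃ s ∈ B,
        (n : ℝ) < ‖s μ‖ * Real.exp (1 / ((n : ℝ) + 1) * ω μ) := by
      intro n
      by_contra h
      push Not at h
      exact hcon ⟨1 / ((n : ℝ) + 1), by positivity, n, fun s hs μ => h μ s hs⟩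
    choose ν s hsB hs using hcon'
    classical
    -- The test sequence will be c_μ = sup_n u μ n. A supremum is taken because the points ν n may
    -- repeat, even infinitely often.
    let u : M → ℕ → ℝ := fun μ n => if ν n = μ then Real.exp (1 / ((n : ℝ) + 1) * ω μ) else 0
    have hu0 : ∀ μ n, 0 ≤ u μ n := fun μ n => by
      simp only [u]
      split_ifs <;> positivity
    -- The supremum is slow at every l: from N on 1/(n+1) is below l, and the finitely many earlier
    -- n go into the constant.
    have hul : ∀ l : ℝ, 0 < l → ∃ C : ℝ, ∀ μ n, u μ n ≤ C * Real.exp (l * ω μ) := by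
      intro l hl
      obtain ⟨N, hN⟩ := exists_nat_one_div_lt hl
      have hS : 0 ≤ ∑ n ∈ Finset.range N, Real.exp (ω (ν n)) :=
        Finset.sum_nonneg fun _ _ => (Real.exp_pos _).le
      refine ⟨∑ n ∈ Finset.range N, Real.exp (ω (ν n)) + 1, fun μ n => ?_⟩
      simp only [u]
      split_ifs with h
      · subst h
        have hω := ω.nonneg (ν n)
        rcases lt_or_ge n N with hn | hn
        · calc Real.exp (1 / ((n : ℝ) + 1) * ω (ν n)) ≤ Real.exp (ω (ν n)) := by
                refine Real.exp_le_exp.2 (mul_le_of_le_one_left hω ?_)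
                rw [div_le_one (by positivity)]
                linarith [n.cast_nonneg (α := ℝ)]
            _ ≤ ∑ n ∈ Finset.range N, Real.exp (ω (ν n)) :=
                Finset.single_le_sum (f := fun n => Real.exp (ω (ν n)))
                  (fun _ _ => (Real.exp_pos _).le) (Finset.mem_range.2 hn)
            _ ≤ (∑ n ∈ Finset.range N, Real.exp (ω (ν n)) + 1) * 1 := by linarith
            _ ≤ _ := by
                gcongr
                exact Real.one_le_exp (by positivity)
        · refine le_trans ?_ (le_mul_of_one_le_left (Real.exp_pos _).le (by linarith))
          refine Real.exp_le_exp.2 (mul_le_mul_of_nonneg_right (le_trans ?_ hN.le) hω)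
          gcongr
      · positivity
    have hbdd : ∀ μ, BddAbove (Set.range (u μ)) := fun μ => by
      obtain ⟨C, hC⟩ := hul 1 one_pos
      exact ⟨_, Set.forall_mem_range.2 (hC μ)⟩
    obtain ⟨A, hA⟩ := hbd ⟨fun μ => (⨆ n, u μ n : ℝ), fun l hl => by
      obtain ⟨C, hC⟩ := hul l hl
      refine (snorm_le_ofReal (A := C) fun μ => ?_).trans_lt ENNReal.ofReal_lt_top
      rw [Complex.norm_real, Real.norm_of_nonneg (Real.iSup_nonneg (hu0 μ)), neg_mul,
        Real.exp_neg, ← div_eq_mul_inv, div_le_iff₀ (Real.exp_pos _)]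
      exact ciSup_le (hC μ)⟩
    -- At ν n the product of c and |s n| exceeds n > A, against the uniform bound A.
    obtain ⟨n, hn⟩ := exists_nat_gt A
    have h1 := hA (s n) (hsB n) (ν n)
    simp only [Complex.norm_real, Real.norm_of_nonneg (Real.iSup_nonneg (hu0 (ν n)))] at h1
    have h2 : Real.exp (1 / ((n : ℝ) + 1) * ω (ν n)) ≤ ⨆ m, u (ν n) m := by
      refine le_trans (le_of_eq ?_) (le_ciSup (hbdd (ν n)) n)
      simp [u]
    have h3 := mul_le_mul_of_nonneg_left h2 (norm_nonneg (s n (ν n)))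
    have h4 := hs n
    rw [mul_comm] at h1
    linarith

/-- A bounded set of rapidly decreasing sequences is dominated by one of them. -/
theorem Rapid.exists_dominating
    (hM : t.coquant fun k => Summable fun μ : M => Real.exp (-(k * ω μ)))
    {B : Set (Rapid t ω M)} (hB : Bornology.IsVonNBounded ℂ B) :
    ∃ b : Rapid t ω M, ∀ s ∈ B, ∀ μ, ‖s μ‖ ≤ ‖b μ‖ := by
  have hq := Rapid.quant_bounded hM hB
  have hbdd : ∀ μ, BddAbove (Set.range fun s : B => ‖s.1 μ‖) := by
    intro μ
    -- Any one admissible exponent makes the pointwise supremum finite; `exists_split` supplies one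
    -- for either type.
    obtain ⟨l, k, -, -, ⟨A, hA⟩, -, -⟩ := UType.exists_split hq hM hM
    refine ⟨A / Real.exp ((l + k) * ω μ), ?_⟩
    rintro _ ⟨s, rfl⟩
    exact (le_div_iff₀ (Real.exp_pos _)).2 (hA s s.2 μ)
  refine ⟨⟨fun μ => (⨆ s : B, ‖s.1 μ‖ : ℝ), UType.quant_mono hq ?_⟩, fun s hs μ => ?_⟩
  · rintro l - ⟨A, hA⟩
    refine (snorm_le_ofReal (A := max A 0) fun μ => ?_).trans_lt ENNReal.ofReal_lt_top
    rw [Complex.norm_real, Real.norm_of_nonneg (Real.iSup_nonneg fun _ => norm_nonneg _),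
      ← le_div_iff₀ (Real.exp_pos _)]
    refine Real.iSup_le (fun s => ?_) (by positivity)
    rw [le_div_iff₀ (Real.exp_pos _)]
    exact (hA s s.2 μ).trans (le_max_left _ _)
  · simp only [Complex.norm_real, Real.norm_of_nonneg (Real.iSup_nonneg fun _ => norm_nonneg _)]
    exact le_ciSup (hbdd μ) ⟨s, hs⟩

/-- Some exponent l is good for both b and the seminorm: b fixes it for the Roumieu type, the
seminorm for the Beurling type. The weighted norm is monotone in the moduli of the entries. -/
theorem Rapid.isVonNBounded_dominated (b : Rapid t ω M) :
    Bornology.IsVonNBounded ℂ {s : Rapid t ω M | ∀ μ, ‖s μ‖ ≤ ‖b μ‖} := by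
  refine Rapid.withSeminorms.isVonNBounded_iff_seminorm_bounded.2 ?_
  rintro ⟨p, hp⟩
  have : ∃ l, snorm ω M l b < ∞ ∧ ∃ C : ℝ≥0, ∀ c : Rapid t ω M,
      ENNReal.ofReal (p c) ≤ C * snorm ω M l c := by
    have hb := b.2
    cases t with
    | beurling =>
      obtain ⟨l, hl, h⟩ := hp
      exact ⟨l, hb l hl, h⟩
    | roumieu =>
      obtain ⟨l, hl, h⟩ := hb
      exact ⟨l, h, hp l hl⟩
  obtain ⟨l, hb, C, hC⟩ := this
  refine ⟨C * (snorm ω M l b).toReal + 1, by positivity, fun s hs => ?_⟩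
  refine lt_of_le_of_lt ?_ (lt_add_one _)
  refine le_mul_toReal_of_ofReal_le hb ((hC s).trans ?_)
  gcongr
  exact snorm_le_of_norm_le hs

/-- A continuous seminorm on `𝓢'` is bounded by a pairing with a rapidly decreasing sequence. -/
theorem Slow.exists_le_tsum (hM : t.coquant fun k => Summable fun μ : M => Real.exp (-(k * ω μ)))
    {p : Seminorm ℂ (Slow t ω M)} (hp : p ∈ Slow.contSeminorms t ω M) :
    ∃ b : Rapid t ω M, ∀ c : Slow t ω M, p c ≤ ∑' μ, ‖c μ‖ * ‖b μ‖ := by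
  -- The sequence is b_μ = p(δ_μ). It decays because δ_μ has norm e^{-lω(μ)} at exponent -l.
  have hb : t.quant fun l => snorm ω M l (fun μ => (p (Slow.unit μ) : ℂ)) < ∞ := by
    refine UType.quant_mono hp ?_
    rintro l - ⟨C, hC⟩
    refine (snorm_le_ofReal (A := C) fun μ => ?_).trans_lt ENNReal.ofReal_lt_top
    have h1 := hC (Slow.unit μ)
    have h2 : snorm ω M (-l) (Slow.unit μ : Slow t ω M) = _ := snorm_unitSeq (-l) μ
    rw [h2] at h1
    have h3 := le_mul_toReal_of_ofReal_le ENNReal.ofReal_lt_top h1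
    rw [ENNReal.toReal_ofReal (Real.exp_pos _).le, neg_mul, Real.exp_neg, ← div_eq_mul_inv,
      le_div_iff₀ (Real.exp_pos _)] at h3
    rwa [Complex.norm_real, Real.norm_of_nonneg (apply_nonneg p _)]
  refine ⟨⟨_, hb⟩, fun c => ?_⟩
  have hs := summable_norm_mul_norm hM c.2 hb
  -- Subadditivity gives the bound on the partial sums of c = ∑ c_μ δ_μ, and continuity of p passes
  -- it to the limit.
  have hpc : Continuous p := Slow.withSeminorms.continuous_seminorm ⟨p, hp⟩
  have hlim := (hpc.tendsto c).comp (Slow.hasSum_unit hM c)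
  refine le_of_tendsto hlim (Eventually.of_forall fun F => ?_)
  refine (Finset.le_sum_of_subadditive p (map_zero p).le (map_add_le_add p) F fun μ => c μ • Slow.unit μ).trans ?_
  refine le_trans (le_of_eq (Finset.sum_congr rfl fun μ _ => ?_))
    (hs.sum_le_tsum F fun μ _ => by positivity)
  rw [map_smul_eq_mul, Complex.norm_real, Real.norm_of_nonneg (apply_nonneg p _)]

theorem pairing_add (hM : t.coquant fun k => Summable fun μ : M => Real.exp (-(k * ω μ)))
    (b c : Slow t ω M) : pairing hM (b + c) = pairing hM b + pairing hM c := by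
  ext s
  refine (hasSum_pairing hM _ s).unique ?_
  refine ((hasSum_pairing hM b s).add (hasSum_pairing hM c s)).congr_fun fun μ => ?_
  exact add_mul (b μ) (c μ) (s μ)

theorem pairing_smul (hM : t.coquant fun k => Summable fun μ : M => Real.exp (-(k * ω μ)))
    (a : ℂ) (c : Slow t ω M) : pairing hM (a • c) = a • pairing hM c := by
  ext s
  refine (hasSum_pairing hM _ s).unique ?_
  refine ((hasSum_pairing hM c s).mul_left a).congr_fun fun μ => ?_
  exact mul_assoc a (c μ) (s μ)

/-- On a bounded set dominated by b, |⟨c, s⟩| is at most ∑ |c_μ| |b_μ|, which is a continuous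
seminorm of c. -/
theorem continuous_pairing (hM : t.coquant fun k => Summable fun μ : M => Real.exp (-(k * ω μ))) :
    Continuous (pairing hM) := by
  let L : Slow t ω M →+ (Rapid t ω M →L[ℂ] ℂ) := AddMonoidHom.mk' (pairing hM) (pairing_add hM)
  refine continuous_of_continuousAt_zero L ?_
  rw [ContinuousAt, map_zero]
  refine (ContinuousLinearMap.hasBasis_nhds_zero_of_basis Metric.nhds_basis_ball).tendsto_right_iff.2
    ?_
  rintro ⟨B, ε⟩ ⟨hB, hε⟩
  obtain ⟨b, hb⟩ := Rapid.exists_dominating hM hB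
  have hp : Continuous (Slow.absPairing hM b) :=
    Slow.withSeminorms.continuous_seminorm ⟨_, Slow.absPairing_mem hM b⟩
  filter_upwards [hp.tendsto' 0 0 (map_zero _) |>.eventually (gt_mem_nhds hε)] with c hc s hs
  rw [mem_ball_zero_iff]
  refine lt_of_le_of_lt ((norm_pairingₗ_le hM c s).trans ?_) hc
  refine (summable_norm_mul_norm hM c.2 s.2).tsum_le_tsum (fun μ => ?_)
    (summable_norm_mul_norm hM c.2 b.2)
  exact mul_le_mul_of_nonneg_left (hb s hs μ) (norm_nonneg _)

theorem exists_pairing_eq_tsum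
    (hM : t.coquant fun k => Summable fun μ : M => Real.exp (-(k * ω μ)))
    (c : Slow t ω M) (b : Rapid t ω M) : ∃ s : Rapid t ω M, (∀ μ, ‖s μ‖ ≤ ‖b μ‖) ∧
      pairing hM c s = (∑' μ, ‖c μ‖ * ‖b μ‖ : ℝ) := by
  -- The phases are chosen so that every term c_μ s_μ is |c_μ| |b_μ|. Where c_μ = 0 the convention x
  -- / 0 = 0 gives s_μ = 0, which does no harm.
  let s : M → ℂ := fun μ => (starRingEnd ℂ (c μ) / ‖c μ‖) * ‖b μ‖
  have hs : ∀ μ, ‖s μ‖ ≤ ‖b μ‖ := by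
    intro μ
    simp only [s, norm_mul, norm_div, RCLike.norm_conj, Complex.norm_real, norm_norm]
    exact mul_le_of_le_one_left (norm_nonneg _) (div_self_le_one _)
  refine ⟨⟨s, UType.quant_mono b.2 fun l _ hl => (snorm_le_of_norm_le hs).trans_lt hl⟩, hs, ?_⟩
  refine (hasSum_pairing hM _ _).unique ?_
  refine (Complex.hasSum_ofReal.2 (summable_norm_mul_norm hM c.2 b.2).hasSum).congr_fun fun μ => ?_
  simp only [s]
  rcases eq_or_ne (c μ) 0 with h | h
  · simp [h]
  · have : (‖c μ‖ : ℂ) ≠ 0 := by exact_mod_cast norm_ne_zero_iff.2 h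
    rw [← mul_assoc, mul_div_assoc', Complex.mul_conj, Complex.normSq_eq_norm_sq]
    push_cast
    field_simp

/-- A continuous seminorm of the coefficients is at most ∑ |c_μ| |b_μ|, and this sum is a value of g
on the bounded set of sequences dominated by b. So smallness of g on that set controls the seminorm.
-/
theorem continuous_coeffSeq (hM : t.coquant fun k => Summable fun μ : M => Real.exp (-(k * ω μ))) :
    Continuous (coeffSeq : (Rapid t ω M →L[ℂ] ℂ) → Slow t ω M) := by
  let L : (Rapid t ω M →L[ℂ] ℂ) →+ Slow t ω M := AddMonoidHom.mk' coeffSeq fun _ _ => rfl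
  refine continuous_of_continuousAt_zero L ?_
  rw [ContinuousAt, map_zero]
  refine (Slow.withSeminorms.tendsto_nhds _ _).2 ?_
  rintro ⟨p, hp⟩ ε hε
  obtain ⟨b, hb⟩ := Slow.exists_le_tsum hM hp
  have hB := (ContinuousLinearMap.hasBasis_nhds_zero_of_basis (σ := RingHom.id ℂ)
    (E := Rapid t ω M) (F := ℂ) Metric.nhds_basis_ball).mem_of_mem
      (i := (_, ε)) ⟨Rapid.isVonNBounded_dominated b, hε⟩
  filter_upwards [hB] with g hg
  obtain ⟨s, hs, hsum⟩ := exists_pairing_eq_tsum hM (coeffSeq g) b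
  have h1 := hg s hs
  rw [mem_ball_zero_iff] at h1
  rw [pairing_coeffSeq] at hsum
  rw [sub_zero]
  refine (hb (coeffSeq g)).trans_lt ?_
  rw [hsum, Complex.norm_real] at h1
  exact (le_abs_self _).trans_lt h1

/-- The pairing identifies `𝓢'` with the strong dual of `𝓢`. -/
def pairingEquiv (hM : t.coquant fun k => Summable fun μ : M => Real.exp (-(k * ω μ))) :
    Slow t ω M ≃L[ℂ] (Rapid t ω M →L[ℂ] ℂ) where
  toFun := pairing hM
  invFun := coeffSeq
  left_inv := coeffSeq_pairing hM
  right_inv := pairing_coeffSeq hM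
  map_add' b c := pairing_add hM b c
  map_smul' a c := pairing_smul hM a c
  continuous_toFun := continuous_pairing hM
  continuous_invFun := continuous_coeffSeq hM

/-! ### Growth of the weight function -/

/-- The spherical shell `8ʲ⁺¹ ≤ |ξ| < 8ʲ⁺²`. -/
def shell (d j : ℕ) : Set (E d) := {ξ | 8 ^ (j + 1) ≤ ‖ξ‖ ∧ ‖ξ‖ < 8 ^ (j + 2)}

theorem measurableSet_shell (j : ℕ) : MeasurableSet (shell d j) :=
  (measurableSet_le measurable_const measurable_norm).inter
    (measurableSet_lt measurable_norm measurable_const)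

theorem pairwise_disjoint_shell : Pairwise (Function.onFun Disjoint (shell d)) := by
  intro i j hne
  wlog hij : i < j generalizing i j
  · exact (this hne.symm (lt_of_le_of_ne (not_lt.1 hij) hne.symm)).symm
  refine Set.disjoint_left.2 fun ξ hi hj => ?_
  have : (8 : ℝ) ^ (i + 2) ≤ 8 ^ (j + 1) := pow_le_pow_right₀ (by norm_num) (by omega)
  exact absurd hj.1 (not_le.2 (hi.2.trans_le this))

theorem Weight.tsum_shell_ne_top (ω : Weight d) :
    ∑' j, ∫⁻ ξ in shell d j, ENNReal.ofReal (ω ξ / ‖ξ‖ ^ (d + 1)) ≠ ∞ := by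
  rw [← lintegral_iUnion measurableSet_shell pairwise_disjoint_shell]
  refine ((lintegral_mono_set ?_).trans_lt ω.beta.lintegral_lt_top).ne
  refine Set.iUnion_subset fun j ξ hξ => ?_
  exact (one_lt_pow₀ (by norm_num : (1 : ℝ) < 8) (by omega)).trans_le hξ.1

/-- The inequality ω(ξ) ≤ ω(η) + ω(ξ - η) is integrated over a ball of η chosen so that η and ξ - η
both stay in the shell. This converts the integral condition (β) into a pointwise bound without any
radial symmetry or continuity of ω. -/
theorem Weight.mul_volume_le (ω : Weight d) (hd : d ≠ 0) (j : ℕ) {ξ : E d}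
    (hξ : ‖ξ‖ ≤ 8 ^ (j + 1)) :
    ENNReal.ofReal (ω ξ) * (ENNReal.ofReal ((8 ^ (j + 1)) ^ d) * volume (Metric.ball (0 : E d) 1)) ≤
      2 * (ENNReal.ofReal ((8 ^ (j + 2)) ^ (d + 1)) *
        ∫⁻ ξ in shell d j, ENNReal.ofReal (ω ξ / ‖ξ‖ ^ (d + 1))) := by
  have : NeZero d := ⟨hd⟩
  set r : ℝ := 8 ^ (j + 1) with hr
  have hr0 : 0 < r := by positivity
  have hr8 : (8 : ℝ) ^ (j + 2) = 8 * r := by rw [hr]; ring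
  -- With |p| = 3r, |η - p| < r and |ξ| ≤ r one has 2r < |η| < 4r and r < |ξ - η| < 5r, inside the
  -- shell from r to 8r. Such a p requires d ≠ 0.
  obtain ⟨p, hp⟩ : ∃ p : E d, ‖p‖ = 3 * r :=
    ⟨EuclideanSpace.single 0 (3 * r), by simp [abs_of_pos hr0]⟩
  set g : E d → ℝ≥0∞ := (shell d j).indicator fun η => ENNReal.ofReal (ω η) with hg
  have hgm : Measurable g := (ω.measurable.ennreal_ofReal).indicator (measurableSet_shell j)
  have hball : volume (Metric.ball p r) =
      ENNReal.ofReal (r ^ d) * volume (Metric.ball (0 : E d) 1) := by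
    rw [Measure.addHaar_ball_of_pos volume p hr0, finrank_euclideanSpace_fin]
  have h1 : ∀ η ∈ Metric.ball p r, ENNReal.ofReal (ω ξ) ≤ g η + g (ξ - η) := by
    intro η hη
    rw [mem_ball_iff_norm] at hη
    have e1 : ‖p‖ ≤ ‖η - p‖ + ‖η‖ := by
      have := norm_sub_norm_le p η
      rw [norm_sub_rev] at this
      linarith
    have e2 : ‖η‖ ≤ ‖η - p‖ + ‖p‖ := by
      have := norm_sub_norm_le η p
      linarith
    have e3 : ‖η‖ - ‖ξ‖ ≤ ‖ξ - η‖ := by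
      rw [norm_sub_rev]
      exact norm_sub_norm_le η ξ
    have e4 := norm_sub_le ξ η
    have m1 : η ∈ shell d j := by
      constructor
      · change r ≤ _
        linarith
      · rw [hr8]
        linarith
    have m2 : ξ - η ∈ shell d j := by
      constructor
      · change r ≤ _
        linarith
      · rw [hr8]
        linarith
    rw [hg, Set.indicator_of_mem m1, Set.indicator_of_mem m2,
      ← ENNReal.ofReal_add (ω.nonneg _) (ω.nonneg _)]
    refine ENNReal.ofReal_le_ofReal ?_
    simpa using ω.subadd η (ξ - η)
  have h2 : ∫⁻ η, g η ≤ ENNReal.ofReal ((8 ^ (j + 2)) ^ (d + 1)) *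
      ∫⁻ ξ in shell d j, ENNReal.ofReal (ω ξ / ‖ξ‖ ^ (d + 1)) := by
    rw [hg, lintegral_indicator (measurableSet_shell j), ← lintegral_const_mul' _ _
      ENNReal.ofReal_ne_top]
    refine setLIntegral_mono' (measurableSet_shell j) fun η hη => ?_
    rw [← ENNReal.ofReal_mul (by positivity)]
    refine ENNReal.ofReal_le_ofReal ?_
    have hη0 : 0 < ‖η‖ := lt_of_lt_of_le (by positivity) hη.1
    rw [mul_div_assoc', le_div_iff₀ (by positivity), mul_comm]
    have := ω.nonneg η
    gcongr
    exact hη.2.le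
  calc ENNReal.ofReal (ω ξ) * (ENNReal.ofReal (r ^ d) * volume (Metric.ball (0 : E d) 1))
      = ∫⁻ _ in Metric.ball p r, ENNReal.ofReal (ω ξ) := by
        rw [setLIntegral_const, hball]
    _ ≤ ∫⁻ η in Metric.ball p r, (g η + g (ξ - η)) :=
        setLIntegral_mono' Metric.isOpen_ball.measurableSet h1
    _ ≤ ∫⁻ η, (g η + g (ξ - η)) := setLIntegral_le_lintegral _ _
    _ = (∫⁻ η, g η) + ∫⁻ η, g η := by
        rw [lintegral_add_left hgm, lintegral_sub_left_eq_self]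
    _ ≤ _ := by
        rw [two_mul]
        exact add_le_add h2 h2

/-- The weight function is bounded on the balls of radius `8ʲ` by numbers `W_j` with
`∑ 8⁻ʲ W_j < ∞`. -/
theorem Weight.exists_summable_bound (ω : Weight d) :
    ∃ W : ℕ → ℝ, (∀ j, 0 ≤ W j) ∧ (∀ j ξ, ‖ξ‖ ≤ 8 ^ j → ω ξ ≤ W j) ∧
      Summable fun j => W j / 8 ^ j := by
  rcases eq_or_ne d 0 with rfl | hd
  · refine ⟨0, fun _ => le_rfl, fun j ξ _ => ?_, by simp⟩
    rw [Subsingleton.elim ξ 0, ω.map_zero]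
    rfl
  · set I : ℕ → ℝ := fun j =>
      (∫⁻ ξ in shell d j, ENNReal.ofReal (ω ξ / ‖ξ‖ ^ (d + 1))).toReal with hI
    have hIs : Summable I := ENNReal.summable_toReal ω.tsum_shell_ne_top
    set β : ℝ := (volume (Metric.ball (0 : E d) 1)).toReal with hβ
    have hβ0 : 0 < β := ENNReal.toReal_pos (Metric.measure_ball_pos _ _ one_pos).ne'
      measure_ball_lt_top.ne
    have hI0 : ∀ j, 0 ≤ I j := fun j => ENNReal.toReal_nonneg
    -- The constant is what remains of 2 (8^{j+2})^{d+1} / ((8^{j+1})^d β) after a factor 8ʲ is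
    -- split off; that factor cancels in the sum of W_j / 8ʲ.
    refine ⟨fun j => (2 * 8 ^ (d + 2) / β) * I j * 8 ^ j, fun j => ?_, fun j ξ hξ => ?_, ?_⟩
    · have := hI0 j
      positivity
    · have h := ω.mul_volume_le hd j
        (hξ.trans (pow_le_pow_right₀ (by norm_num) (Nat.le_succ j)))
      have hfin : ∫⁻ ξ in shell d j, ENNReal.ofReal (ω ξ / ‖ξ‖ ^ (d + 1)) ≠ ∞ :=
        ENNReal.ne_top_of_tsum_ne_top ω.tsum_shell_ne_top j
      have h' := ENNReal.toReal_mono (by finiteness) h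
      simp only [ENNReal.toReal_mul, ENNReal.toReal_ofReal (ω.nonneg ξ),
        ENNReal.toReal_ofReal (pow_nonneg (pow_nonneg (by norm_num : (0 : ℝ) ≤ 8) _) _),
        ENNReal.toReal_ofNat] at h'
      change ω ξ * ((8 ^ (j + 1)) ^ d * β) ≤ 2 * ((8 ^ (j + 2)) ^ (d + 1) * I j) at h'
      have e : (2 * 8 ^ (d + 2) / β) * I j * 8 ^ j =
          2 * ((8 ^ (j + 2)) ^ (d + 1) * I j) / ((8 ^ (j + 1)) ^ d * β) := by
        have e1 : (8 : ℝ) ^ (j + 2) = 8 * 8 ^ (j + 1) := by ring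
        rw [eq_div_iff (by positivity), e1, mul_pow]
        field_simp
        ring
      refine le_of_le_of_eq ?_ e.symm
      rw [le_div_iff₀ (by positivity)]
      exact h'
    · refine (hIs.mul_left (2 * 8 ^ (d + 2) / β)).congr fun j => ?_
      rw [mul_div_cancel_right₀ _ (by positivity)]

/-- A summable sequence remains summable after multiplication with a suitable sequence that tends
to infinity. -/
theorem exists_tendsto_atTop_summable_mul {a : ℕ → ℝ} (ha : ∀ j, 0 ≤ a j) (hs : Summable a) :
    ∃ κ : ℕ → ℝ, (∀ j, 0 ≤ κ j) ∧ Tendsto κ atTop atTop ∧ Summable fun j => κ j * a j := by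
  -- The geometric term makes every tail sum r_j strictly positive, so that κ_j = 1/√(r_j) is
  -- legitimate.
  set b : ℕ → ℝ := fun j => a j + (1 / 2) ^ j with hb
  have hb0 : ∀ j, 0 < b j := fun j => add_pos_of_nonneg_of_pos (ha j) (by positivity)
  have hbs : Summable b := hs.add (summable_geometric_of_lt_one (by norm_num) (by norm_num))
  set r : ℕ → ℝ := fun j => ∑' k, b (k + j) with hr
  have hrs : ∀ j, r j = b j + r (j + 1) := fun j => by
    rw [hr]
    simp only
    rw [((summable_nat_add_iff j).2 hbs).tsum_eq_zero_add]
    simp only [zero_add, add_right_comm _ 1 j, add_assoc]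
  have hr0 : ∀ j, 0 < r j := fun j =>
    ((summable_nat_add_iff j).2 hbs).tsum_pos (fun k => (hb0 _).le) 0 (hb0 _)
  have hrt : Tendsto r atTop (𝓝 0) := tendsto_sum_nat_add b
  refine ⟨fun j => (√(r j))⁻¹, fun j => by positivity, ?_, ?_⟩
  · refine Tendsto.inv_tendsto_nhdsGT_zero (tendsto_nhdsWithin_iff.2 ⟨?_, ?_⟩)
    · simpa [Function.comp_def] using (Real.continuous_sqrt.tendsto 0).comp hrt
    · exact Eventually.of_forall fun j => Real.sqrt_pos.2 (hr0 j)
  · have hle : ∀ j, (√(r j))⁻¹ * b j ≤ 2 * (√(r j) - √(r (j + 1))) := by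
      intro j
      have h1 := Real.sq_sqrt (hr0 j).le
      have h2 := Real.sq_sqrt (hr0 (j + 1)).le
      have h3 : 0 < √(r j) := Real.sqrt_pos.2 (hr0 j)
      have h5 : √(r (j + 1)) ≤ √(r j) := Real.sqrt_le_sqrt (by linarith [hrs j, hb0 j])
      rw [inv_mul_le_iff₀ h3]
      have h6 : b j = √(r j) ^ 2 - √(r (j + 1)) ^ 2 := by rw [h1, h2]; linarith [hrs j]
      rw [h6]
      nlinarith [Real.sqrt_nonneg (r (j + 1))]
    have hsum : Summable fun j => (√(r j))⁻¹ * b j := by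
      refine summable_of_sum_range_le (c := 2 * √(r 0))
        (fun j => mul_nonneg (by positivity) (hb0 j).le) fun n => ?_
      refine (Finset.sum_le_sum fun j _ => hle j).trans ?_
      rw [← Finset.mul_sum, Finset.sum_range_sub']
      linarith [Real.sqrt_nonneg (r n)]
    refine Summable.of_nonneg_of_le (fun j => mul_nonneg (by positivity) (ha j)) (fun j => ?_) hsum
    gcongr
    simp only [hb, le_add_iff_nonneg_right]
    positivity

/-! ### Iterated averages -/

/-- The average of `g` over the segment from `x` to `x - v`. -/
def avg (v : E d) (g : E d → ℂ) (x : E d) : ℂ := ∫ t in (0 : ℝ)..1, g (x - t • v)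

/-- The Fourier multiplier of `avg v` is `avgMult ⟪v, ξ⟫`. -/
def avgMult (s : ℝ) : ℂ := ∫ t in (0 : ℝ)..1, Complex.exp (-(2 * Real.pi * s * Complex.I) * t)

theorem avgMult_zero : avgMult 0 = 1 := by simp [avgMult]

theorem norm_avgMult_le_one (s : ℝ) : ‖avgMult s‖ ≤ 1 := by
  refine (intervalIntegral.norm_integral_le_of_norm_le_const (C := 1) fun t _ => ?_).trans
    (by simp)
  rw [Complex.norm_exp]
  simp

/-- The integral is (1 - e^{-2πis})/(2πis), of modulus at most 1/(π|s|), and π > e. -/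
theorem norm_avgMult_le_exp {s : ℝ} (hs : 1 ≤ |s|) : ‖avgMult s‖ ≤ Real.exp (-1) := by
  have hs0 : s ≠ 0 := by
    rintro rfl
    norm_num at hs
  have hc : -(2 * Real.pi * s * Complex.I) ≠ 0 := by
    simp [hs0, Real.pi_ne_zero]
  have h3 : Real.exp 1 ≤ Real.pi := by
    linarith [Real.exp_one_lt_d9, Real.pi_gt_d2]
  rw [avgMult, integral_exp_mul_complex hc, norm_div, Real.exp_neg, div_le_iff₀ (by positivity)]
  have h1 : ‖Complex.exp (-(2 * Real.pi * s * Complex.I) * (1 : ℝ)) -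
      Complex.exp (-(2 * Real.pi * s * Complex.I) * (0 : ℝ))‖ ≤ 1 + 1 := by
    refine (norm_sub_le _ _).trans (add_le_add ?_ ?_) <;> simp [Complex.norm_exp]
  refine h1.trans ?_
  simp only [norm_neg, norm_mul, Complex.norm_ofNat, Complex.norm_real, Real.norm_eq_abs,
    Complex.norm_I, mul_one, abs_of_pos Real.pi_pos]
  rw [← div_eq_inv_mul, le_div_iff₀ (Real.exp_pos 1)]
  nlinarith [Real.pi_pos]

variable {v : E d} {g : E d → ℂ} {L : ℝ≥0}

theorem intervalIntegrable_avg (hg : Continuous g) (x : E d) :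
    IntervalIntegrable (fun t : ℝ => g (x - t • v)) volume 0 1 :=
  Continuous.intervalIntegrable (by fun_prop) _ _

theorem lipschitzWith_avg (hg : LipschitzWith L g) : LipschitzWith L (avg v g) := by
  refine LipschitzWith.of_dist_le_mul fun x y => ?_
  rw [dist_eq_norm, avg, avg, ← intervalIntegral.integral_sub (intervalIntegrable_avg hg.continuous x)
    (intervalIntegrable_avg hg.continuous y)]
  refine (intervalIntegral.norm_integral_le_of_norm_le_const (C := L * dist x y)
    fun t _ => ?_).trans (by simp)
  rw [← dist_eq_norm]
  simpa using hg.dist_le_mul (x - t • v) (y - t • v)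

/-- Averaging keeps the Lipschitz constant L, so this bound applies at every stage of the iteration
and the total displacement is at most L ∑ |v_k|. -/
theorem dist_avg_le (hg : LipschitzWith L g) (x : E d) : dist (g x) (avg v g x) ≤ L * ‖v‖ := by
  have h : avg v g x - g x = ∫ t in (0 : ℝ)..1, (g (x - t • v) - g x) := by
    rw [intervalIntegral.integral_sub (intervalIntegrable_avg hg.continuous x) (by simp)]
    simp [avg]
  rw [dist_comm, dist_eq_norm, h]
  refine (intervalIntegral.norm_integral_le_of_norm_le_const (C := L * ‖v‖)
    fun t ht => ?_).trans (by simp)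
  rw [Set.uIoc_of_le zero_le_one] at ht
  rw [← dist_eq_norm]
  refine (hg.dist_le_mul _ _).trans ?_
  gcongr
  rw [dist_eq_norm, sub_sub_cancel_left, norm_neg, norm_smul, Real.norm_of_nonneg ht.1.le]
  exact mul_le_of_le_one_left (norm_nonneg _) ht.2

theorem norm_avg_le {C : ℝ} (hg : ∀ x, ‖g x‖ ≤ C) (x : E d) : ‖avg v g x‖ ≤ C :=
  (intervalIntegral.norm_integral_le_of_norm_le_const fun _ _ => hg _).trans (by simp)

theorem avg_eq_zero {R : ℝ} (hg : ∀ x, R < ‖x‖ → g x = 0) {x : E d} (hx : R + ‖v‖ < ‖x‖) :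
    avg v g x = 0 := by
  refine (intervalIntegral.integral_congr (g := fun _ => 0) fun t ht => ?_).trans (by simp)
  rw [Set.uIcc_of_le zero_le_one] at ht
  refine hg _ ?_
  have h1 : ‖t • v‖ ≤ ‖v‖ := by
    rw [norm_smul, Real.norm_of_nonneg ht.1]
    exact mul_le_of_le_one_left (norm_nonneg _) ht.2
  linarith [norm_sub_norm_le x (t • v)]

theorem fourier_translate_eq (g : E d → ℂ) (y ξ : E d) :
    ∫ x, Complex.exp (((-2 * Real.pi * ⟪x, ξ⟫ : ℝ) : ℂ) * Complex.I) * g (x - y) =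
      Complex.exp (-(2 * Real.pi * ⟪y, ξ⟫ * Complex.I)) * 𝓕 g ξ := by
  rw [Real.fourier_eq', ← integral_const_mul]
  refine Eq.trans ?_ (integral_sub_right_eq_self _ y)
  congr 1
  ext x
  rw [smul_eq_mul, ← mul_assoc, ← Complex.exp_add]
  congr 2
  rw [inner_sub_left]
  push_cast
  ring

theorem fourier_avg (hg : Continuous g) (hgi : Integrable g) (ξ : E d) :
    𝓕 (avg v g) ξ = avgMult ⟪v, ξ⟫ * 𝓕 g ξ := by
  have hint : Integrable (Function.uncurry fun (x : E d) (t : ℝ) =>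
      Complex.exp (((-2 * Real.pi * ⟪x, ξ⟫ : ℝ) : ℂ) * Complex.I) * g (x - t • v))
      (volume.prod (volume.restrict (Set.Ioc (0 : ℝ) 1))) := by
    refine (integrable_prod_iff' ?_).2 ⟨Eventually.of_forall fun t => ?_, ?_⟩
    · refine Continuous.aestronglyMeasurable ?_
      fun_prop
    · have h1 : Integrable fun x => g (x - t • v) := hgi.comp_sub_right (t • v)
      have h2 : Continuous fun x : E d =>
          Complex.exp (((-2 * Real.pi * ⟪x, ξ⟫ : ℝ) : ℂ) * Complex.I) := by fun_prop
      exact h1.bdd_mul (c := 1) h2.aestronglyMeasurable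
        (Eventually.of_forall fun x => (Complex.norm_exp_ofReal_mul_I _).le)
    · have : ∀ t : ℝ, ∫ x, ‖Function.uncurry (fun (x : E d) (t : ℝ) =>
          Complex.exp (((-2 * Real.pi * ⟪x, ξ⟫ : ℝ) : ℂ) * Complex.I) * g (x - t • v)) (x, t)‖ =
          ∫ x, ‖g x‖ := by
        intro t
        simp only [Function.uncurry_apply_pair, norm_mul, Complex.norm_exp_ofReal_mul_I, one_mul]
        exact integral_sub_right_eq_self (fun x => ‖g x‖) _
      simp_rw [this]
      exact integrable_const _
  calc 𝓕 (avg v g) ξ = ∫ x, ∫ t in Set.Ioc (0 : ℝ) 1,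
        Complex.exp (((-2 * Real.pi * ⟪x, ξ⟫ : ℝ) : ℂ) * Complex.I) * g (x - t • v) := by
        rw [Real.fourier_eq']
        congr 1
        ext x
        rw [smul_eq_mul, avg, intervalIntegral.integral_of_le zero_le_one, ← integral_const_mul]
    _ = ∫ t in Set.Ioc (0 : ℝ) 1, ∫ x,
        Complex.exp (((-2 * Real.pi * ⟪x, ξ⟫ : ℝ) : ℂ) * Complex.I) * g (x - t • v) :=
        integral_integral_swap hint
    _ = _ := by
        rw [avgMult, intervalIntegral.integral_of_le zero_le_one, ← integral_mul_const]
        congr 1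
        ext t
        rw [fourier_translate_eq, inner_smul_left]
        congr 2
        simp only [conj_trivial]
        push_cast
        ring

/-- The iterated averages of `g` along the vectors `v 0, v 1, …`. -/
def iterAvg (v : ℕ → E d) (g : E d → ℂ) : ℕ → E d → ℂ
  | 0 => g
  | n + 1 => avg (v n) (iterAvg v g n)

section iterAvg

variable {v : ℕ → E d} {g : E d → ℂ} {L : ℝ≥0}

theorem lipschitzWith_iterAvg (hg : LipschitzWith L g) : ∀ n, LipschitzWith L (iterAvg v g n)
  | 0 => hg
  | n + 1 => lipschitzWith_avg (lipschitzWith_iterAvg hg n)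

theorem norm_iterAvg_le {C : ℝ} (hg : ∀ x, ‖g x‖ ≤ C) : ∀ n x, ‖iterAvg v g n x‖ ≤ C
  | 0 => hg
  | n + 1 => norm_avg_le (norm_iterAvg_le hg n)

theorem iterAvg_eq_zero {R : ℝ} (hg : ∀ x, R < ‖x‖ → g x = 0) :
    ∀ n x, R + ∑ k ∈ Finset.range n, ‖v k‖ < ‖x‖ → iterAvg v g n x = 0
  | 0 => fun x hx => hg x (by simpa using hx)
  | n + 1 => fun x hx => avg_eq_zero (iterAvg_eq_zero hg n) (by
      rwa [Finset.sum_range_succ, ← add_assoc] at hx)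

theorem fourier_iterAvg (hg : LipschitzWith L g) {R : ℝ} (hR : ∀ x, R < ‖x‖ → g x = 0) (ξ : E d) :
    ∀ n, 𝓕 (iterAvg v g n) ξ = (∏ k ∈ Finset.range n, avgMult ⟪v k, ξ⟫) * 𝓕 g ξ
  | 0 => by simp [iterAvg]
  | n + 1 => by
    have hc := (lipschitzWith_iterAvg (v := v) hg n).continuous
    have hs : HasCompactSupport (iterAvg v g n) :=
      HasCompactSupport.intro (isCompact_closedBall 0 (R + ∑ k ∈ Finset.range n, ‖v k‖))
        fun x hx => iterAvg_eq_zero hR n x (by simpa using hx)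
    rw [iterAvg, fourier_avg hc (hc.integrable_of_hasCompactSupport hs), fourier_iterAvg hg hR ξ n,
      Finset.prod_range_succ]
    ring

/-- If `∑ |v_k| < ∞`, then the iterated averages converge. -/
theorem exists_iterAvg_limit (hv : Summable fun k => ‖v k‖) (hg : LipschitzWith L g)
    {R : ℝ} (hR : ∀ x, R < ‖x‖ → g x = 0) :
    ∃ φ : E d → ℂ, Continuous φ ∧ HasCompactSupport φ ∧
      ∀ ξ, Tendsto (fun n => (∏ k ∈ Finset.range n, avgMult ⟪v k, ξ⟫) * 𝓕 g ξ) atTop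
        (𝓝 (𝓕 φ ξ)) := by
  have hgs : HasCompactSupport g :=
    HasCompactSupport.intro (isCompact_closedBall 0 R) fun x hx => hR x (by simpa using hx)
  obtain ⟨C, hC⟩ := hgs.exists_bound_of_continuous hg.continuous
  have hcau : ∀ x, ∃ y, Tendsto (fun n => iterAvg v g n x) atTop (𝓝 y) := fun x =>
    cauchySeq_tendsto_of_complete <| cauchySeq_of_dist_le_of_summable (fun n => L * ‖v n‖)
      (fun n => dist_avg_le (lipschitzWith_iterAvg hg n) x) (hv.mul_left _)
  choose φ hφ using hcau
  set R' : ℝ := R + ∑' k, ‖v k‖ with hR'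
  have hz : ∀ n x, R' < ‖x‖ → iterAvg v g n x = 0 := fun n x hx =>
    iterAvg_eq_zero hR n x (lt_of_le_of_lt
      (add_le_add le_rfl (hv.sum_le_tsum _ fun _ _ => norm_nonneg _)) hx)
  have hφz : ∀ x, R' < ‖x‖ → φ x = 0 := fun x hx =>
    tendsto_nhds_unique (hφ x) (by simp [hz _ x hx])
  have hφL : LipschitzWith L φ := LipschitzWith.of_dist_le_mul fun x y =>
    le_of_tendsto ((hφ x).dist (hφ y))
      (Eventually.of_forall fun n => (lipschitzWith_iterAvg hg n).dist_le_mul x y)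
  refine ⟨φ, hφL.continuous, HasCompactSupport.intro (isCompact_closedBall 0 R')
    fun x hx => hφz x (by simpa using hx), fun ξ => ?_⟩
  simp_rw [← fourier_iterAvg hg hR ξ, Real.fourier_eq']
  refine tendsto_integral_of_dominated_convergence
    ((Metric.closedBall (0 : E d) R').indicator fun _ => C) (fun n => ?_) ?_ (fun n => ?_) ?_
  · have := (lipschitzWith_iterAvg (v := v) hg n).continuous
    exact Continuous.aestronglyMeasurable (by fun_prop)
  · rw [integrable_indicator_iff measurableSet_closedBall]
    exact integrableOn_const measure_closedBall_lt_top.ne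
  · refine Eventually.of_forall fun x => ?_
    rw [norm_smul, Complex.norm_exp_ofReal_mul_I, one_mul]
    by_cases hx : x ∈ Metric.closedBall 0 R'
    · rw [Set.indicator_of_mem hx]
      exact norm_iterAvg_le hC n x
    · rw [hz n x (by simpa using hx), Set.indicator_of_notMem hx, norm_zero]
  · exact Eventually.of_forall fun x => (hφ x).const_smul _

end iterAvg

/-- A kernel `φ` with integral `1` whose Fourier transform at `ξ` is at most `e^{-n}` if
`|⟪v i, ξ⟫| ≥ 1` for `n` of the vectors `v i`. -/
theorem exists_kernel {ι : Type*} [Countable ι] {v : ι → E d} (hv : Summable fun i => ‖v i‖) :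
    ∃ φ : E d → ℂ, Continuous φ ∧ HasCompactSupport φ ∧ 𝓕 φ 0 = 1 ∧
      ∀ ξ (F : Finset ι), (∀ i ∈ F, 1 ≤ |⟪v i, ξ⟫|) → ‖𝓕 φ ξ‖ ≤ Real.exp (-F.card) := by
  obtain ⟨e, he⟩ := exists_injective_nat ι
  -- The family is listed along ℕ through an injection; indices that are not hit carry the zero
  -- vector, whose multiplier is 1.
  set w : ℕ → E d := Function.extend e v fun _ => 0 with hw
  have hwe : ∀ i, w (e i) = v i := fun i => he.extend_apply v _ i
  have hws : Summable fun k => ‖w k‖ := by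
    refine (he.summable_iff fun k hk => ?_).1 (hv.congr fun i => ?_)
    · rw [hw, Function.extend_apply' v _ k (by simpa using hk)]
      simp
    · simp [hwe]
  let f : ContDiffBump (0 : E d) := ⟨1, 2, one_pos, one_lt_two⟩
  set g : E d → ℂ := fun x => (f.normed volume x : ℂ) with hg
  have hg1 : ∫ x, ‖g x‖ = 1 := by
    simp only [hg, Complex.norm_real, Real.norm_of_nonneg (f.nonneg_normed _)]
    exact f.integral_normed
  obtain ⟨L, hL⟩ : ∃ L, LipschitzWith L g := by
    obtain ⟨L, hL⟩ := ContDiff.lipschitzWith_of_hasCompactSupport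
      (f.hasCompactSupport_normed (μ := volume)) (f.contDiff_normed (n := 1)) one_ne_zero
    refine ⟨1 * L, Complex.isometry_ofReal.lipschitz.comp hL⟩
  have hR : ∀ x, f.rOut < ‖x‖ → g x = 0 := by
    intro x hx
    have : x ∉ Function.support (f.normed volume) := by
      rw [f.support_normed_eq]
      simpa using hx.le
    simpa [hg] using this
  obtain ⟨φ, hφc, hφs, hφ⟩ := exists_iterAvg_limit hws hL hR
  refine ⟨φ, hφc, hφs, ?_, fun ξ F hF => ?_⟩
  · refine tendsto_nhds_unique (hφ 0) ?_
    have : 𝓕 g 0 = 1 := by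
      rw [Real.fourier_eq']
      simp only [inner_zero_right, mul_zero, Complex.ofReal_zero, zero_mul, Complex.exp_zero,
        one_smul, hg]
      rw [integral_complex_ofReal, f.integral_normed, Complex.ofReal_one]
    simp [avgMult_zero, this]
  · refine le_of_tendsto (hφ ξ).norm ?_
    have hsub : ∀ᶠ n in atTop, F.map ⟨e, he⟩ ⊆ Finset.range n :=
      tendsto_finset_range.eventually_ge_atTop _
    filter_upwards [hsub] with n hn
    have h1 : ‖𝓕 g ξ‖ ≤ 1 := by
      rw [Real.fourier_eq']
      refine (norm_integral_le_integral_norm _).trans (le_of_eq ?_)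
      simp only [norm_smul, Complex.norm_exp_ofReal_mul_I, one_mul]
      exact hg1
    rw [norm_mul, norm_prod]
    refine (mul_le_of_le_one_right (Finset.prod_nonneg fun _ _ => norm_nonneg _) h1).trans ?_
    -- The factors from F contribute at most e⁻¹ each, all others at most 1.
    rw [← Finset.prod_sdiff hn]
    refine (mul_le_of_le_one_left (Finset.prod_nonneg fun _ _ => norm_nonneg _)
      (Finset.prod_le_one (fun _ _ => norm_nonneg _) fun _ _ => norm_avgMult_le_one _)).trans ?_
    rw [Finset.prod_map]
    refine (Finset.prod_le_prod (g := fun _ => Real.exp (-1)) (fun _ _ => norm_nonneg _)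
      fun i hi => ?_).trans (le_of_eq ?_)
    · refine norm_avgMult_le_exp ?_
      simpa [hwe] using hF i hi
    · rw [Finset.prod_const, ← Real.exp_nat_mul]
      simp

theorem exists_le_abs_coord (ξ : E d) (hξ : 0 < ‖ξ‖) : ∃ i, ‖ξ‖ / (d + 1) ≤ |ξ i| := by
  by_contra! h
  have h1 : ‖ξ‖ ≤ ∑ i, |ξ i| := by
    rw [EuclideanSpace.norm_eq]
    refine Real.sqrt_le_iff.2 ⟨Finset.sum_nonneg fun _ _ => abs_nonneg _, ?_⟩
    simp only [Real.norm_eq_abs]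
    exact Finset.sum_sq_le_sq_sum_of_nonneg fun _ _ => abs_nonneg _
  have h2 : ∑ i, |ξ i| ≤ ∑ _i : Fin d, ‖ξ‖ / (d + 1) := Finset.sum_le_sum fun i _ => (h i).le
  rw [Finset.sum_const, Finset.card_univ, Fintype.card_fin, nsmul_eq_mul] at h2
  have h3 : (d : ℝ) * (‖ξ‖ / (d + 1)) < ‖ξ‖ := by
    rw [mul_div_assoc', div_lt_iff₀ (by positivity)]
    nlinarith
  linarith

/-- There is a compactly supported kernel with integral `1` that is of class `𝓓_(ω)`. -/
theorem Weight.exists_kernel (ω : Weight d) : ∃ φ : E d → ℂ, Continuous φ ∧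
    HasCompactSupport φ ∧ 𝓕 φ 0 = 1 ∧ ∀ l : ℝ, 0 < l → fnorm ω l φ < ∞ := by
  obtain ⟨W, hW0, hW, hWs⟩ := ω.exists_summable_bound
  obtain ⟨κ, hκ0, hκ, hκs⟩ := exists_tendsto_atTop_summable_mul
    (fun j => div_nonneg (hW0 j) (by positivity)) hWs
  -- For each j, N_j averages are taken along every coordinate axis. The length 8(d+1)/8ʲ is
  -- dictated by |ξ| > 8^{j-1}: some coordinate is at least |ξ|/(d+1), and the inner product is then
  -- at least 1. Summability of κ_j W_j / 8ʲ keeps the total length finite.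
  let N : ℕ → ℕ := fun j => ⌈κ j * W j⌉₊
  let v : (Σ j, Fin (N j) × Fin d) → E d := fun i =>
    EuclideanSpace.single i.2.2 ((8 * (d + 1) : ℝ) / 8 ^ i.1)
  have hv : Summable fun i => ‖v i‖ := by
    refine (summable_sigma_of_nonneg fun _ => norm_nonneg _).2
      ⟨fun j => (hasSum_fintype _).summable, ?_⟩
    have hs : Summable fun j => (κ j * (W j / 8 ^ j) + (1 / 8 : ℝ) ^ j) * (d * (8 * (d + 1))) :=
      (hκs.add (summable_geometric_of_lt_one (by norm_num) (by norm_num))).mul_right _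
    refine Summable.of_nonneg_of_le (fun j => tsum_nonneg fun _ => norm_nonneg _) (fun j => ?_) hs
    have h1 : (N j : ℝ) ≤ κ j * W j + 1 :=
      (Nat.ceil_lt_add_one (mul_nonneg (hκ0 j) (hW0 j))).le
    have h2 : ∀ p : Fin (N j) × Fin d, ‖v ⟨j, p⟩‖ = 8 * (d + 1) / 8 ^ j := by
      intro p
      rw [PiLp.norm_single, Real.norm_of_nonneg (by positivity)]
    simp only [tsum_fintype, h2, Finset.sum_const, Finset.card_univ, Fintype.card_prod,
      Fintype.card_fin, nsmul_eq_mul, Nat.cast_mul]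
    calc (N j : ℝ) * d * (8 * (d + 1) / 8 ^ j)
        ≤ (κ j * W j + 1) * d * (8 * (d + 1) / 8 ^ j) := by gcongr
      _ = _ := by
        rw [one_div, inv_pow]
        ring
  obtain ⟨φ, hc, hs, h1, hφ⟩ := Ultra.exists_kernel hv
  refine ⟨φ, hc, hs, h1, fun l hl => ?_⟩
  -- Beyond 8ᴶ one has κ_j ≥ l and the gain e^{-N_j} beats e^{lW_j}; inside, the trivial bound by
  -- e^{lW_J} suffices.
  obtain ⟨J, hJ⟩ := (hκ.eventually_ge_atTop l).exists_forall_of_atTop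
  refine lt_of_le_of_lt (b := ENNReal.ofReal (Real.exp (l * W J)))
    (fnorm_le_iff.2 fun ξ => ENNReal.ofReal_le_ofReal ?_) ENNReal.ofReal_lt_top
  have hφ1 : ‖𝓕 φ ξ‖ ≤ 1 := by simpa using hφ ξ ∅ (by simp)
  rcases le_or_gt ‖ξ‖ (8 ^ J) with hξ | hξ
  · rw [← one_mul (Real.exp (l * W J))]
    gcongr
    exact hW J ξ hξ
  · have hex : ∃ j, ‖ξ‖ ≤ 8 ^ j := by
      obtain ⟨j, hj⟩ := pow_unbounded_of_one_lt ‖ξ‖ (by norm_num : (1 : ℝ) < 8)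
      exact ⟨j, hj.le⟩
    classical
    set j := Nat.find hex with hj
    have hjξ : ‖ξ‖ ≤ 8 ^ j := Nat.find_spec hex
    have hJj : J < j := by
      by_contra h
      exact absurd (hjξ.trans (pow_le_pow_right₀ (by norm_num) (not_lt.1 h))) (not_le.2 hξ)
    have hj1 : (8 : ℝ) ^ j = 8 * 8 ^ (j - 1) := by
      rw [← pow_succ', Nat.sub_add_cancel (by omega)]
    have hjξ' : (8 : ℝ) ^ (j - 1) < ‖ξ‖ := not_le.1 (Nat.find_min hex (by omega))
    obtain ⟨i, hi⟩ := exists_le_abs_coord ξ (lt_of_lt_of_le (by positivity) hjξ'.le)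
    have h2 := hφ ξ (Finset.univ.image fun m : Fin (N j) => ⟨j, (m, i)⟩) (by
      simp only [Finset.mem_image, Finset.mem_univ, true_and]
      rintro _ ⟨m, rfl⟩
      simp only [v, EuclideanSpace.inner_single_left, conj_trivial, abs_mul]
      rw [abs_of_nonneg (by positivity), hj1]
      calc (1 : ℝ) ≤ 8 * (d + 1) / (8 * 8 ^ (j - 1)) * (8 ^ (j - 1) / (d + 1)) := by
            field_simp
            exact le_rfl
        _ ≤ 8 * (d + 1) / (8 * 8 ^ (j - 1)) * (‖ξ‖ / (d + 1)) := by gcongr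
        _ ≤ _ := by gcongr)
    rw [Finset.card_image_of_injective _ (by
      intro m n hmn
      simpa using hmn), Finset.card_univ, Fintype.card_fin] at h2
    have h3 : κ j * W j ≤ N j := Nat.le_ceil _
    calc ‖𝓕 φ ξ‖ * Real.exp (l * ω ξ) ≤ Real.exp (-(N j : ℝ)) * Real.exp (l * W j) := by
          gcongr
          exact hW j ξ hjξ
      _ ≤ 1 := by
          rw [← Real.exp_add, Real.exp_le_one_iff]
          nlinarith [hJ j hJj.le, hW0 j]
      _ ≤ _ := Real.one_le_exp (mul_nonneg hl.le (hW0 J))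

/-! ### Exponentials -/

theorem continuous_expFun (y : E d) : Continuous (Test.expFun y) := by
  unfold Test.expFun
  fun_prop

theorem expFun_add_left (y z x : E d) :
    Test.expFun (y + z) x = Test.expFun y x * Test.expFun z x := by
  rw [Test.expFun, Test.expFun, Test.expFun, ← Complex.exp_add, inner_add_left]
  push_cast
  ring_nf

theorem expFun_add_right (y x z : E d) :
    Test.expFun y (x + z) = Test.expFun y x * Test.expFun y z := by
  rw [Test.expFun, Test.expFun, Test.expFun, ← Complex.exp_add, inner_add_right]
  push_cast
  ring_nf

theorem expFun_zero_left (x : E d) : Test.expFun 0 x = 1 := by simp [Test.expFun]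

theorem norm_expFun (y x : E d) : ‖Test.expFun y x‖ = 1 := by
  simp [Test.expFun, Complex.norm_exp]

theorem integral_mul_expFun (φ : E d → ℂ) (y : E d) :
    ∫ x, φ x * Test.expFun y x = 𝓕 φ (-y) := by
  rw [Real.fourier_eq']
  congr 1
  ext x
  rw [mul_comm, smul_eq_mul, Test.expFun]
  congr 2
  rw [inner_neg_right, real_inner_comm]
  push_cast
  ring

/-! ### Lattices -/

section Lattice

variable (Λ : Submodule ℤ (E d))

theorem expFun_lattice {ν μ : E d} (hν : ν ∈ dualLattice Λ) (hμ : μ ∈ Λ) :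
    Test.expFun ν μ = 1 := by
  obtain ⟨n, hn⟩ := Submodule.mem_one.1 (hν μ hμ)
  have hn' : ⟪ν, μ⟫ = (n : ℝ) := by simpa using hn.symm
  rw [Test.expFun, hn', Complex.exp_eq_one_iff]
  exact ⟨n, by push_cast; ring⟩

theorem expFun_add_lattice {ν μ : E d} (hν : ν ∈ dualLattice Λ) (hμ : μ ∈ Λ) (x : E d) :
    Test.expFun ν (x + μ) = Test.expFun ν x := by
  rw [expFun_add_right, expFun_lattice Λ hν hμ, mul_one]

/-- The sum over all lattice translates. -/
def periodization (φ : E d → ℂ) (x : E d) : ℂ := ∑' μ : Λ, φ (x + μ)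

theorem periodization_add (φ : E d → ℂ) {μ : E d} (hμ : μ ∈ Λ) (x : E d) :
    periodization Λ φ (x + μ) = periodization Λ φ x := by
  refine ((Equiv.addLeft (⟨μ, hμ⟩ : Λ)).tsum_eq _).symm.trans ?_ |>.symm
  refine tsum_congr fun ν => ?_
  simp [add_assoc]

variable [DiscreteTopology Λ]

theorem finite_lattice_of_isBounded {A : Set (E d)} (hA : Bornology.IsBounded A) :
    {μ : Λ | (μ : E d) ∈ A}.Finite := by
  have h : (A ∩ (Λ : Set (E d))).Finite := by
    refine Metric.finite_isBounded_inter_isClosed DiscreteTopology.isDiscrete hA ?_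
    rw [← Submodule.coe_toAddSubgroup]
    have : DiscreteTopology Λ.toAddSubgroup := inferInstanceAs (DiscreteTopology Λ)
    exact AddSubgroup.isClosed_of_discrete
  refine (h.preimage (f := ((↑) : Λ → E d)) Subtype.val_injective.injOn).subset fun μ hμ => ?_
  exact ⟨hμ, μ.2⟩

theorem finite_translates {A B : Set (E d)} (hA : Bornology.IsBounded A)
    (hB : Bornology.IsBounded B) : {μ : Λ | ∃ x ∈ A, x + μ ∈ B}.Finite := by
  refine (finite_lattice_of_isBounded Λ (hB.sub hA)).subset ?_
  rintro μ ⟨x, hx, hxμ⟩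
  exact ⟨x + μ, hxμ, x, hx, by simp⟩

/-- Comparison with |μ|^{-(r+1)}, r being the rank, which is summable over the lattice. -/
theorem summable_exp_neg_of_log_le (ω : Weight d) {k A : ℝ}
    (h : ∀ᶠ ξ in Bornology.cobounded (E d),
      (Module.finrank ℤ Λ + 1) * Real.log (1 + ‖ξ‖) ≤ k * ω ξ + A) :
    Summable fun μ : Λ => Real.exp (-(k * ω μ)) := by
  have hs := (ZLattice.summable_norm_rpow Λ (-(Module.finrank ℤ Λ + 1)) (by linarith)).mul_left
    (Real.exp A)
  refine hs.of_norm_bounded_eventually ?_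
  have hev := h.and (eventually_cobounded_le_norm (E := E d) 1)
  obtain ⟨s, hs, hs'⟩ := (Filter.hasBasis_cobounded_norm (E := E d)).eventually_iff.1 hev
  have hfin := finite_lattice_of_isBounded Λ (Metric.isBounded_ball (x := (0 : E d)) (r := s))
  filter_upwards [hfin.compl_mem_cofinite] with μ hμ
  have hsμ : s ≤ ‖(μ : E d)‖ := by simpa using hμ
  obtain ⟨h1, h2⟩ := hs' hsμ
  have h0 : 0 < ‖(μ : E d)‖ := one_pos.trans_le h2
  rw [Real.norm_of_nonneg (Real.exp_pos _).le, Submodule.coe_norm, Real.rpow_def_of_pos h0,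
    ← Real.exp_add]
  refine Real.exp_le_exp.2 ?_
  have h3 : Real.log ‖(μ : E d)‖ ≤ Real.log (1 + ‖(μ : E d)‖) :=
    Real.log_le_log h0 (by linarith)
  have h4 : (0 : ℝ) ≤ Module.finrank ℤ Λ + 1 := by positivity
  nlinarith [mul_le_mul_of_nonneg_left h3 h4]

/-- The growth conditions enter the sequence spaces here. (γ) makes e^{-kω} summable for one large
k; (γ₀) does so for every k > 0, as the Roumieu quantifier demands. -/
theorem coquant_summable_exp (ω : Weight d) (t : UType) (hω : t = UType.roumieu → ω.GammaZero) :
    t.coquant fun k => Summable fun μ : Λ => Real.exp (-(k * ω μ)) := by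
  cases t with
  | beurling =>
    obtain ⟨a, C, hC, h⟩ := ω.gamma
    refine ⟨(Module.finrank ℤ Λ + 1) / C, by positivity, ?_⟩
    refine summable_exp_neg_of_log_le Λ ω (A := -((Module.finrank ℤ Λ + 1) / C * a))
      (Eventually.of_forall fun ξ => ?_)
    have h1 : 0 ≤ (Module.finrank ℤ Λ + 1) / C := by positivity
    have h2 := mul_le_mul_of_nonneg_left (h ξ) h1
    have h3 : (Module.finrank ℤ Λ + 1) / C * (C * Real.log (1 + ‖ξ‖)) =
        (Module.finrank ℤ Λ + 1) * Real.log (1 + ‖ξ‖) := by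
      field_simp
    linarith
  | roumieu =>
    intro k hk
    refine summable_exp_neg_of_log_le Λ ω (A := 0) ?_
    filter_upwards [(hω rfl).eventually_ge_atTop ((Module.finrank ℤ Λ + 1) / k),
      eventually_cobounded_le_norm (E := E d) 1] with ξ h1 h2
    have h3 : 0 < Real.log (1 + ‖ξ‖) := Real.log_pos (by linarith)
    rw [div_le_div_iff₀ hk h3] at h1
    linarith

theorem exists_finset_periodization {φ : E d → ℂ} (hs : HasCompactSupport φ) {A : Set (E d)}
    (hA : Bornology.IsBounded A) : ∃ F : Finset Λ, ∀ x ∈ A, ∀ μ ∉ F, φ (x + μ) = 0 := by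
  refine ⟨(finite_translates Λ hA hs.isCompact.isBounded).toFinset, fun x hx μ hμ => ?_⟩
  by_contra h
  exact hμ (by simpa using ⟨x, hx, subset_tsupport _ h⟩)

theorem continuous_periodization {φ : E d → ℂ} (hc : Continuous φ) (hs : HasCompactSupport φ) :
    Continuous (periodization Λ φ) := by
  refine continuous_iff_continuousAt.2 fun x => ?_
  obtain ⟨F, hF⟩ := exists_finset_periodization Λ hs (Metric.isBounded_ball (x := x) (r := 1))
  have h : Continuous fun y => ∑ μ ∈ F, φ (y + μ) := by fun_prop
  refine h.continuousAt.congr ?_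
  filter_upwards [Metric.ball_mem_nhds x one_pos] with y hy
  exact (tsum_eq_sum fun μ hμ => hF y hy μ hμ).symm

variable [IsZLattice ℝ Λ]

theorem exists_basis_dualLattice : ∃ b : Module.Basis (Module.Free.ChooseBasisIndex ℤ Λ) ℝ (E d),
    dualLattice Λ = Submodule.span ℤ (Set.range b) := by
  classical
  have hB : (innerₗ (E d)).Nondegenerate := by
    constructor
    · intro x hx
      exact inner_self_eq_zero.1 (hx x)
    · intro x hx
      exact inner_self_eq_zero.1 (hx x)
  refine ⟨LinearMap.BilinForm.dualBasis (innerₗ (E d)) hB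
    ((Module.Free.chooseBasis ℤ Λ).ofZLatticeBasis ℝ), ?_⟩
  rw [← LinearMap.BilinForm.dualSubmodule_span_of_basis, Module.Basis.ofZLatticeBasis_span]

instance : DiscreteTopology (dualLattice Λ) := by
  obtain ⟨b, hb⟩ := exists_basis_dualLattice Λ
  rw [hb]
  infer_instance

/-- A bounded fundamental domain of the lattice. -/
def fundDomain : Set (E d) :=
  ZSpan.fundamentalDomain ((Module.Free.chooseBasis ℤ Λ).ofZLatticeBasis ℝ)

theorem isAddFundamentalDomain : IsAddFundamentalDomain Λ (fundDomain Λ) volume :=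
  ZLattice.isAddFundamentalDomain _ _

theorem measurableSet_fundDomain : MeasurableSet (fundDomain Λ) :=
  ZSpan.fundamentalDomain_measurableSet _

theorem isBounded_fundDomain : Bornology.IsBounded (fundDomain Λ) :=
  ZSpan.fundamentalDomain_isBounded _

theorem integrableOn_fundDomain {F : E d → ℂ} (hF : Continuous F) :
    IntegrableOn F (fundDomain Λ) :=
  (hF.continuousOn.integrableOn_compact (isBounded_fundDomain Λ).isCompact_closure).mono_set
    subset_closure

instance : VAddInvariantMeasure Λ (E d) volume :=
  inferInstanceAs (VAddInvariantMeasure Λ.toAddSubgroup (E d) volume)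

instance : MeasurableVAdd Λ (E d) :=
  inferInstanceAs (MeasurableVAdd Λ.toAddSubgroup (E d))

/-- Unfolding: ℝᵈ is cut into translates of the fundamental domain. Compact support leaves finitely
many terms, so sum and integral may be exchanged. -/
theorem integral_mul_periodic {φ G : E d → ℂ} (hc : Continuous φ) (hs : HasCompactSupport φ)
    (hG : Continuous G) (hGp : ∀ μ ∈ Λ, ∀ x, G (x + μ) = G x) :
    ∫ x, φ x * G x = ∫ x in fundDomain Λ, periodization Λ φ x * G x := by
  obtain ⟨F, hF⟩ := exists_finset_periodization Λ hs (isBounded_fundDomain Λ)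
  have hi : Integrable fun x => φ x * G x :=
    (hc.mul hG).integrable_of_hasCompactSupport hs.mul_right
  rw [(isAddFundamentalDomain Λ).integral_eq_tsum'' _ hi]
  have h1 : ∀ μ : Λ, ∫ x in fundDomain Λ, φ (μ +ᵥ x) * G (μ +ᵥ x) =
      ∫ x in fundDomain Λ, φ (x + μ) * G x := by
    intro μ
    congr 1
    ext x
    rw [Submodule.vadd_def, vadd_eq_add, add_comm, hGp μ μ.2]
  simp_rw [h1]
  rw [tsum_eq_sum (s := F), ← integral_finsetSum]
  · refine setIntegral_congr_fun (measurableSet_fundDomain Λ) fun x hx => ?_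
    beta_reduce
    rw [← Finset.sum_mul, periodization, tsum_eq_sum fun μ hμ => hF x hx μ hμ]
  · exact fun μ _ => integrableOn_fundDomain Λ (by fun_prop)
  · intro μ hμ
    refine (setIntegral_congr_fun (g := fun _ => 0) (measurableSet_fundDomain Λ)
      fun x hx => ?_).trans (by simp)
    beta_reduce
    rw [hF x hx μ hμ, zero_mul]

/-! ### Completeness of the characters -/

/-- In lattice coordinates the characters of the torus are exponentials of integral linear forms; ν
represents the form ∑ n_i x_i and is in the dual lattice because the form is integral on Λ. -/
theorem expFun_mem_span_range (n : Module.Free.ChooseBasisIndex ℤ Λ → ℤ) :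
    ∃ ν ∈ dualLattice Λ, ∀ x, Test.expFun ν x = UnitAddTorus.mFourier n
      fun i => (((Module.Free.chooseBasis ℤ Λ).ofZLatticeBasis ℝ).repr x i : UnitAddCircle) := by
  set b := (Module.Free.chooseBasis ℤ Λ).ofZLatticeBasis ℝ with hb
  let f : E d →ₗ[ℝ] ℝ := ∑ i, (n i : ℝ) • b.coord i
  have hf : ∀ x, f x = ∑ i, n i * b.repr x i := fun x => by simp [f]
  let ν : E d := (InnerProductSpace.toDual ℝ (E d)).symm f.toContinuousLinearMap
  have hν : ∀ x, ⟪ν, x⟫ = f x := fun x => by simp [ν]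
  refine ⟨ν, fun y hy => ?_, fun x => ?_⟩
  · rw [innerₗ_apply_apply, hν, hf]
    have hy' : y ∈ Submodule.span ℤ (Set.range b) := by
      rwa [hb, Module.Basis.ofZLatticeBasis_span]
    rw [Module.Basis.mem_span_iff_repr_mem] at hy'
    choose m hm using hy'
    refine Submodule.mem_one.2 ⟨∑ i, n i * m i, ?_⟩
    simp [← hm]
  · rw [Test.expFun, hν, hf, UnitAddTorus.mFourier, ContinuousMap.coe_mk]
    simp only [fourier_coe_apply]
    rw [← Complex.exp_sum]
    congr 1
    push_cast
    rw [Finset.mul_sum]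
    refine Finset.sum_congr rfl fun i _ => ?_
    ring

/-- A continuous periodic function is a uniform limit of trigonometric polynomials. -/
theorem exists_trig_approx {F : E d → ℂ} (hF : Continuous F) (hFp : ∀ μ ∈ Λ, ∀ x, F (x + μ) = F x)
    {ε : ℝ} (hε : 0 < ε) :
    ∃ T ∈ Submodule.span ℂ (Set.range fun ν : dualLattice Λ => Test.expFun (ν : E d)),
      ∀ x, ‖F x - T x‖ ≤ ε := by
  set b := (Module.Free.chooseBasis ℤ Λ).ofZLatticeBasis ℝ with hb
  let π : E d → UnitAddTorus (Module.Free.ChooseBasisIndex ℤ Λ) :=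
    fun x i => (b.repr x i : UnitAddCircle)
  -- The coordinate map is a quotient onto the torus whose fibres are cosets of Λ, so F descends to
  -- a continuous function there, where trigonometric polynomials are dense.
  have hπ : IsOpenQuotientMap π := by
    have h1 : IsOpenQuotientMap b.equivFunL := b.equivFunL.toHomeomorph.isOpenQuotientMap
    have h2 : IsOpenQuotientMap (Pi.map fun _ : Module.Free.ChooseBasisIndex ℤ Λ =>
        ((↑) : ℝ → UnitAddCircle)) :=
      IsOpenQuotientMap.piMap fun _ => QuotientAddGroup.isOpenQuotientMap_mk
    exact h2.comp h1
  let πc : C(E d, UnitAddTorus (Module.Free.ChooseBasisIndex ℤ Λ)) := ⟨π, hπ.continuous⟩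
  have hfac : ∀ x y, πc x = πc y → (⟨F, hF⟩ : C(E d, ℂ)) x = (⟨F, hF⟩ : C(E d, ℂ)) y := by
    intro x y hxy
    have hmem : y - x ∈ Λ := by
      have : y - x ∈ Submodule.span ℤ (Set.range b) := by
        rw [Module.Basis.mem_span_iff_repr_mem]
        intro i
        have h1 : (b.repr x i : UnitAddCircle) = b.repr y i := congrFun hxy i
        obtain ⟨n, hn⟩ := AddSubgroup.mem_zmultiples_iff.1 (QuotientAddGroup.eq.1 h1)
        refine ⟨n, ?_⟩
        rw [map_sub, Finsupp.sub_apply]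
        simp only [zsmul_eq_mul, mul_one] at hn
        simp only [algebraMap_int_eq, eq_intCast]
        linarith
      rwa [hb, Module.Basis.ofZLatticeBasis_span] at this
    have := hFp _ hmem x
    rw [add_sub_cancel] at this
    exact this.symm
  have hq : IsQuotientMap πc := hπ.isQuotientMap
  let G : C(UnitAddTorus (Module.Free.ChooseBasisIndex ℤ Λ), ℂ) := hq.lift ⟨F, hF⟩ hfac
  have hG : ∀ x, G (π x) = F x := fun x => by
    have := congrArg (fun f : C(E d, ℂ) => f x) (hq.lift_comp ⟨F, hF⟩ hfac)
    exact this
  have hmem : G ∈ (Submodule.span ℂ (Set.range <| UnitAddTorus.mFourier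
      (d := Module.Free.ChooseBasisIndex ℤ Λ))).topologicalClosure := by
    rw [UnitAddTorus.span_mFourier_closure_eq_top]
    trivial
  obtain ⟨H, hH, hGH⟩ := Metric.mem_closure_iff.1 hmem ε hε
  refine ⟨fun x => H (π x), ?_, fun x => ?_⟩
  · clear hGH
    induction hH using Submodule.span_induction with
    | mem f hf =>
      obtain ⟨n, rfl⟩ := hf
      obtain ⟨ν, hν, h⟩ := expFun_mem_span_range Λ n
      exact Submodule.subset_span ⟨⟨ν, hν⟩, funext h⟩
    | zero => exact Submodule.zero_mem _
    | add f g _ _ hf hg => exact Submodule.add_mem _ hf hg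
    | smul a f _ hf => exact Submodule.smul_mem _ a hf
  · rw [← hG x, ← dist_eq_norm]
    exact (ContinuousMap.dist_apply_le_dist _).trans hGH.le

/-- A continuous periodic function with vanishing Fourier coefficients is zero. -/
theorem eq_zero_of_fourier_coeff {F : E d → ℂ} (hF : Continuous F)
    (hFp : ∀ μ ∈ Λ, ∀ x, F (x + μ) = F x)
    (h0 : ∀ ν ∈ dualLattice Λ, ∫ x in fundDomain Λ, F x * Test.expFun ν x = 0) : F = 0 := by
  have hFc : Continuous fun x => starRingEnd ℂ (F x) := Complex.continuous_conj.comp hF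
  have hT : ∀ T ∈ Submodule.span ℂ (Set.range fun ν : dualLattice Λ => Test.expFun (ν : E d)),
      Continuous T ∧ ∫ x in fundDomain Λ, F x * T x = 0 := by
    intro T hT
    induction hT using Submodule.span_induction with
    | mem f hf =>
      obtain ⟨ν, rfl⟩ := hf
      exact ⟨continuous_expFun _, h0 ν ν.2⟩
    | zero => exact ⟨continuous_zero, by simp⟩
    | add f g _ _ hf hg =>
      refine ⟨hf.1.add hg.1, ?_⟩
      simp only [Pi.add_apply, mul_add]
      refine (integral_add (integrableOn_fundDomain Λ (hF.mul hf.1))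
        (integrableOn_fundDomain Λ (hF.mul hg.1))).trans ?_
      exact (congrArg₂ (· + ·) hf.2 hg.2).trans (add_zero _)
    | smul a f _ hf =>
      refine ⟨hf.1.const_smul a, ?_⟩
      simp only [Pi.smul_apply, smul_eq_mul, mul_left_comm _ a]
      rw [integral_const_mul, hf.2, mul_zero]
  set A := ∫ x in fundDomain Λ, ‖F x‖ with hA
  have hA0 : 0 ≤ A := integral_nonneg fun _ => norm_nonneg _
  -- The hypothesis says that F is orthogonal to all T without conjugation. Approximating the
  -- conjugate of F by T turns ∫ |F|² into the integral of F times a uniformly small function.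
  have hsq : ∫ x in fundDomain Λ, F x * starRingEnd ℂ (F x) = 0 := by
    refine norm_le_zero_iff.1 (le_of_forall_pos_le_add fun ε hε => ?_)
    obtain ⟨T, hTs, hTF⟩ := exists_trig_approx Λ hFc (fun μ hμ x => by rw [hFp μ hμ])
      (ε := ε / (A + 1)) (by positivity)
    obtain ⟨hTc, hT0⟩ := hT T hTs
    have h1 : ∫ x in fundDomain Λ, F x * starRingEnd ℂ (F x) =
        ∫ x in fundDomain Λ, F x * (starRingEnd ℂ (F x) - T x) := by
      simp only [mul_sub]
      refine ((integral_sub (integrableOn_fundDomain Λ (hF.mul hFc))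
        (integrableOn_fundDomain Λ (hF.mul hTc))).trans ?_).symm
      exact (congrArg _ hT0).trans (sub_zero _)
    rw [h1, zero_add]
    calc ‖∫ x in fundDomain Λ, F x * (starRingEnd ℂ (F x) - T x)‖
        ≤ ∫ x in fundDomain Λ, ‖F x‖ * (ε / (A + 1)) := by
          refine norm_integral_le_of_norm_le
            ((integrableOn_fundDomain Λ hF).norm.mul_const _) (Eventually.of_forall fun x => ?_)
          rw [norm_mul]
          gcongr
          exact hTF x
      _ = A * (ε / (A + 1)) := integral_mul_const _ _
      _ ≤ ε := by
          rw [mul_div_assoc', div_le_iff₀ (by positivity)]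
          nlinarith
  have hsq' : ∫ x in fundDomain Λ, ‖F x‖ ^ 2 = 0 := by
    have : ∀ x, F x * starRingEnd ℂ (F x) = ((‖F x‖ ^ 2 : ℝ) : ℂ) := fun x => by
      rw [Complex.mul_conj, Complex.normSq_eq_norm_sq]
    simp_rw [this] at hsq
    rw [integral_complex_ofReal] at hsq
    exact_mod_cast hsq
  have hint : IntegrableOn (fun x => ‖F x‖ ^ 2) (fundDomain Λ) := by
    have hc : Continuous fun x => ‖F x‖ ^ 2 := by fun_prop
    exact (hc.continuousOn.integrableOn_compact
      (isBounded_fundDomain Λ).isCompact_closure).mono_set subset_closure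
  rw [integral_eq_zero_iff_of_nonneg (fun x => by positivity) hint] at hsq'
  have hnull : volume ({x | F x ≠ 0} ∩ fundDomain Λ) = 0 := by
    rw [← Measure.restrict_apply (isOpen_ne_fun hF continuous_const).measurableSet]
    refine (ae_iff.1 hsq').symm ▸ measure_congr ?_
    refine Eventually.of_forall fun x => ?_
    simp
  have hnull' : volume {x | F x ≠ 0} = 0 := by
    refine (isAddFundamentalDomain Λ).measure_zero_of_invariant _ (fun μ => ?_) hnull
    ext x
    rw [Set.mem_vadd_set_iff_neg_vadd_mem]
    have h1 : -μ +ᵥ x = x + ((-μ : Λ) : E d) := by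
      rw [Submodule.vadd_def, vadd_eq_add, add_comm]
    rw [h1]
    simp only [Set.mem_ofPred_eq, hFp _ (-μ).2 x]
  refine (Continuous.ae_eq_iff_eq volume hF continuous_zero).1 ?_
  exact ae_iff.2 hnull'

/-! ### Partitions of unity -/

variable {Λ}

theorem integral_mul_periodic_of_partition {η G : E d → ℂ} (hc : Continuous η)
    (hs : HasCompactSupport η) (hη : IsPartitionOfUnity Λ η) (hG : Continuous G)
    (hGp : ∀ μ ∈ Λ, ∀ x, G (x + μ) = G x) :
    ∫ x, η x * G x = ∫ x in fundDomain Λ, G x := by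
  rw [integral_mul_periodic Λ hc hs hG hGp]
  refine setIntegral_congr_fun (measurableSet_fundDomain Λ) fun x _ => ?_
  simp only [periodization, (hη x).tsum_eq, one_mul]

theorem integral_partition {η : E d → ℂ} (hc : Continuous η)
    (hs : HasCompactSupport η) (hη : IsPartitionOfUnity Λ η) :
    ∫ x, η x = (ZLattice.covolume Λ : ℂ) := by
  have h := integral_mul_periodic_of_partition hc hs hη (G := fun _ => 1) continuous_const
    fun _ _ _ => rfl
  simp only [mul_one] at h
  rw [h, ZLattice.covolume_eq_measure_fundamentalDomain Λ volume (isAddFundamentalDomain Λ)]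
  simp

/-- Both η and its translate by v are partitions of unity, so both give the integral of e_ν over a
fundamental domain. With e_ν(v) = -1 the translation also changes the sign. -/
theorem integral_partition_mul_expFun {η : E d → ℂ} (hc : Continuous η)
    (hs : HasCompactSupport η) (hη : IsPartitionOfUnity Λ η) {ν : E d} (hν : ν ∈ dualLattice Λ)
    (hν0 : ν ≠ 0) : ∫ x, η x * Test.expFun ν x = 0 := by
  have hp : ∀ μ ∈ Λ, ∀ x, Test.expFun ν (x + μ) = Test.expFun ν x :=
    fun μ hμ x => expFun_add_lattice Λ hν hμ x
  obtain ⟨v, hv⟩ : ∃ v : E d, Test.expFun ν v = -1 := by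
    refine ⟨(1 / (2 * ‖ν‖ ^ 2) : ℝ) • ν, ?_⟩
    have hn : ‖ν‖ ≠ 0 := norm_ne_zero_iff.2 hν0
    have : ⟪ν, (1 / (2 * ‖ν‖ ^ 2) : ℝ) • ν⟫ = 1 / 2 := by
      rw [inner_smul_right, real_inner_self_eq_norm_sq]
      field_simp
    rw [Test.expFun, this, ← Complex.exp_pi_mul_I]
    congr 1
    push_cast
    ring
  have hη' : IsPartitionOfUnity Λ fun x => η (x - v) := fun x => by
    simpa only [sub_add_eq_add_sub] using hη (x - v)
  have h1 := integral_mul_periodic_of_partition hc hs hη (continuous_expFun ν) hp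
  have h2 := integral_mul_periodic_of_partition (η := fun x => η (x - v)) (by fun_prop)
    (hs.comp_homeomorph (Homeomorph.subRight v)) hη' (continuous_expFun ν) hp
  have h3 : ∫ x, η (x - v) * Test.expFun ν x = -∫ x, η x * Test.expFun ν x := by
    rw [← integral_neg, ← integral_add_right_eq_self _ v]
    congr 1
    ext x
    rw [add_sub_cancel_right, expFun_add_right, hv]
    ring
  rw [h3, ← h1] at h2
  exact neg_eq_self.1 h2

end Lattice

/-! ### Weighted bounds for Fourier transforms -/

theorem mul_exp_le_fnorm {ω : Weight d} {l : ℝ} {φ : E d → ℂ} (h : fnorm ω l φ < ∞) (ξ : E d) :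
    ‖𝓕 φ ξ‖ * Real.exp (l * ω ξ) ≤ (fnorm ω l φ).toReal :=
  (ENNReal.ofReal_le_iff_le_toReal h.ne).1 (fnorm_le_iff.1 le_rfl ξ)

theorem fnorm_le_ofReal {ω : Weight d} {l A : ℝ} {φ : E d → ℂ}
    (h : ∀ ξ, ‖𝓕 φ ξ‖ * Real.exp (l * ω ξ) ≤ A) : fnorm ω l φ ≤ ENNReal.ofReal A :=
  fnorm_le_iff.2 fun ξ => ENNReal.ofReal_le_ofReal (h ξ)

theorem continuous_fourier {φ : E d → ℂ} (hφ : Integrable φ) : Continuous (𝓕 φ) :=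
  VectorFourier.fourierIntegral_continuous Real.continuous_fourierChar
    (by exact continuous_inner) hφ

theorem norm_fourier_le (φ : E d → ℂ) (ξ : E d) : ‖𝓕 φ ξ‖ ≤ ∫ x, ‖φ x‖ := by
  rw [Real.fourier_eq']
  refine (norm_integral_le_integral_norm _).trans (le_of_eq ?_)
  simp only [norm_smul, Complex.norm_exp_ofReal_mul_I, one_mul]

/-! ### Existence of smooth partitions of unity -/

section

variable (Λ : Submodule ℤ (E d)) [DiscreteTopology Λ] [IsZLattice ℝ Λ]

-- The translates of the indicator χ tile space, so the translates of its convolution with φ sum to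
-- ∫ φ = 1. The transform is the product of the two, bounded by ‖χ‖₁ times that of φ, hence of
-- Beurling class.
open scoped Convolution in
theorem exists_partitionOfUnity (ω : Weight d) :
    ∃ η : Test UType.beurling ω, IsPartitionOfUnity Λ η := by
  obtain ⟨φ, hc, hs, h1, hφ⟩ := ω.exists_kernel
  set χ : E d → ℂ := (fundDomain Λ).indicator 1 with hχ
  have hχi : Integrable χ := by
    rw [hχ, integrable_indicator_iff (measurableSet_fundDomain Λ)]
    exact integrableOn_fundDomain Λ continuous_one
  have hχs : HasCompactSupport χ :=
    HasCompactSupport.intro (isBounded_fundDomain Λ).isCompact_closure fun x hx =>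
      Set.indicator_of_notMem (fun h => hx (subset_closure h)) _
  have hφi : Integrable φ := hc.integrable_of_hasCompactSupport hs
  have hconv : ∀ x, (χ ⋆[ContinuousLinearMap.mul ℂ ℂ] φ) x = ∫ y in fundDomain Λ, φ (x - y) := by
    intro x
    rw [convolution, ← integral_indicator (measurableSet_fundDomain Λ)]
    congr 1
    ext y
    by_cases hy : y ∈ fundDomain Λ
    · simp [hχ, hy]
    · simp [hχ, hy]
  refine ⟨⟨χ ⋆[ContinuousLinearMap.mul ℂ ℂ] φ,
    hs.continuous_convolution_right _ hχi.locallyIntegrable hc, hχs.convolution _ hs,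
    fun l hl => ?_⟩, fun x => ?_⟩
  · refine (fnorm_le_ofReal (A := (∫ x, ‖χ x‖) * (fnorm ω l φ).toReal) fun ξ => ?_).trans_lt
      ENNReal.ofReal_lt_top
    rw [Real.fourier_mul_convolution_eq hχi hφi, norm_mul, mul_assoc]
    gcongr
    · exact norm_fourier_le χ ξ
    · exact mul_exp_le_fnorm (hφ l hl) ξ
  · change HasSum (fun μ : Λ => (χ ⋆[ContinuousLinearMap.mul ℂ ℂ] φ) (x + μ)) 1
    simp_rw [hconv]
    have hA : Bornology.IsBounded ((fun y => x - y) '' fundDomain Λ) := by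
      rw [← Set.singleton_sub]
      exact Bornology.isBounded_singleton.sub (isBounded_fundDomain Λ)
    obtain ⟨F, hF⟩ := exists_finset_periodization Λ hs hA
    have hz : ∀ μ ∉ F, ∫ y in fundDomain Λ, φ (x + μ - y) = 0 := by
      intro μ hμ
      refine (setIntegral_congr_fun (g := fun _ => 0) (measurableSet_fundDomain Λ)
        fun y hy => ?_).trans (by simp)
      have := hF (x - y) ⟨y, hy, rfl⟩ μ hμ
      rwa [sub_add_eq_add_sub] at this
    have htot : ∫ y, φ (x - y) = 1 := by
      rw [integral_sub_left_eq_self φ volume x, ← h1, Real.fourier_eq']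
      simp
    have h2 := (isAddFundamentalDomain Λ).integral_eq_tsum' (fun y => φ (x - y))
      (hφi.comp_sub_left x)
    have h3 : ∀ μ : Λ, ∫ y in fundDomain Λ, φ (x - (-μ +ᵥ y)) =
        ∫ y in fundDomain Λ, φ (x + μ - y) := by
      intro μ
      congr 1
      ext y
      rw [Submodule.vadd_def, vadd_eq_add, Submodule.coe_neg, sub_add_eq_sub_sub, sub_neg_eq_add]
    simp_rw [h3] at h2
    rw [← htot, h2]
    exact (summable_of_ne_finset_zero hz).hasSum

end

/-! ### Products of test functions -/

theorem Weight.exists_integrable_exp (ω : Weight d) :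
    ∃ k : ℝ, 0 < k ∧ Integrable fun ξ => Real.exp (-(k * ω ξ)) := by
  obtain ⟨a, C, hC, h⟩ := ω.gamma
  refine ⟨(d + 1) / C, by positivity, ?_⟩
  have hi := (integrable_one_add_norm (E := E d) (μ := volume) (r := d + 1)
    (by rw [finrank_euclideanSpace_fin]; linarith)).const_mul (Real.exp (-((d + 1) / C * a)))
  refine hi.mono' ?_ (Eventually.of_forall fun ξ => ?_)
  · exact (Real.measurable_exp.comp (ω.measurable.const_mul _).neg).aestronglyMeasurable
  · rw [Real.norm_of_nonneg (Real.exp_pos _).le, Real.rpow_def_of_pos (by positivity),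
      ← Real.exp_add]
    refine Real.exp_le_exp.2 ?_
    have h1 : (0 : ℝ) ≤ (d + 1) / C := by positivity
    have h2 := mul_le_mul_of_nonneg_left (h ξ) h1
    have h3 : (d + 1) / C * (C * Real.log (1 + ‖ξ‖)) = (d + 1) * Real.log (1 + ‖ξ‖) := by
      field_simp
    linarith

theorem integrable_fourier_mul_exp {ω : Weight d} {k l : ℝ} {η : E d → ℂ} (hη : Integrable η)
    (hk : Integrable fun ξ => Real.exp (-(k * ω ξ))) (hf : fnorm ω (l + k) η < ∞) :
    Integrable fun ξ => ‖𝓕 η ξ‖ * Real.exp (l * ω ξ) := by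
  refine (hk.const_mul (fnorm ω (l + k) η).toReal).mono' ?_ (Eventually.of_forall fun ξ => ?_)
  · refine ((continuous_fourier hη).norm.measurable.mul ?_).aestronglyMeasurable
    exact Real.measurable_exp.comp (ω.measurable.const_mul _)
  · rw [Real.norm_of_nonneg (by positivity)]
    calc ‖𝓕 η ξ‖ * Real.exp (l * ω ξ)
        = ‖𝓕 η ξ‖ * Real.exp ((l + k) * ω ξ) * Real.exp (-(k * ω ξ)) := by
          rw [mul_assoc, ← Real.exp_add]
          ring_nf
      _ ≤ _ := by
          gcongr
          exact mul_exp_le_fnorm hf ξ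

/-- The factor ψ is only integrable, so inversion is applied to η alone: in the multiplication
formula ∫ F̂ g = ∫ F ĝ one takes F = η̂ and g(x) = ψ(-x) e_ξ(x). -/
theorem fourier_mul {η ψ : E d → ℂ} (hc : Continuous η) (hη : Integrable η)
    (hη' : Integrable (𝓕 η)) (hψ : Integrable ψ) (ξ : E d) :
    𝓕 (fun x => η x * ψ x) ξ = ∫ ζ, 𝓕 η ζ * 𝓕 ψ (ξ - ζ) := by
  set g : E d → ℂ := fun x => ψ (-x) * Test.expFun ξ x with hg
  have hgi : Integrable g :=
    hψ.comp_neg.mul_bdd (c := 1) (continuous_expFun ξ).aestronglyMeasurable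
      (Eventually.of_forall fun x => (norm_expFun ξ x).le)
  have hgf : ∀ ζ, 𝓕 g ζ = 𝓕 ψ (ξ - ζ) := by
    intro ζ
    have h1 : 𝓕 (fun x => ψ (-x)) = 𝓕⁻ ψ := (Real.fourierInv_eq_fourier_comp_neg ψ).symm
    rw [hg, Test.fourier_modulate (fun x => ψ (-x)) ξ ζ, h1, Real.fourierInv_eq_fourier_neg,
      neg_sub]
  have hinv : ∀ x, 𝓕 (𝓕 η) x = η (-x) := by
    intro x
    have h1 := congrFun (hc.fourierInv_fourier_eq hη hη') (-x)
    rwa [Real.fourierInv_eq_fourier_neg, neg_neg] at h1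
  have hflip : ∫ x, 𝓕 (𝓕 η) x * g x = ∫ ζ, 𝓕 η ζ * 𝓕 g ζ := by
    have h := VectorFourier.integral_fourierIntegral_smul_eq_flip (V := E d) (W := E d)
      (L := innerₗ (E d)) (μ := volume) (ν := volume) Real.continuous_fourierChar
      (by exact continuous_inner) hη' hgi
    rw [flip_innerₗ] at h
    exact h
  simp_rw [← hgf]
  rw [← hflip, ← neg_neg ξ, ← integral_mul_expFun, ← integral_neg_eq_self]
  congr 1
  ext x
  rw [hinv, hg]
  simp only [Test.expFun, inner_neg_right, inner_neg_left, neg_neg]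
  ring

/-- Multiplication of test functions with a test function of Beurling type does not increase
their class. -/
theorem fnorm_mul_lt_top {ω : Weight d} (η : Test UType.beurling ω) {l : ℝ} (hl : 0 < l)
    {ψ : E d → ℂ} (hψ : Integrable ψ) (hψl : fnorm ω l ψ < ∞) :
    fnorm ω l (fun x => η x * ψ x) < ∞ := by
  obtain ⟨k, hk0, hk⟩ := ω.exists_integrable_exp
  have h1 := integrable_fourier_mul_exp η.integrable hk (η.2.2.2 (l + k) (by positivity))
  have h0 : Integrable (𝓕 (η : E d → ℂ)) := by
    have := integrable_fourier_mul_exp (l := 0) η.integrable hk (by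
      rw [zero_add]
      exact η.2.2.2 k hk0)
    simp only [zero_mul, Real.exp_zero, mul_one] at this
    exact (integrable_norm_iff (continuous_fourier η.integrable).aestronglyMeasurable).1 this
  refine (fnorm_le_ofReal (A := (∫ ζ, ‖𝓕 (η : E d → ℂ) ζ‖ * Real.exp (l * ω ζ)) *
    (fnorm ω l ψ).toReal) fun ξ => ?_).trans_lt ENNReal.ofReal_lt_top
  rw [fourier_mul η.2.1 η.integrable h0 hψ, ← le_div_iff₀ (Real.exp_pos _), ← integral_mul_const,
    ← integral_div]
  refine norm_integral_le_of_norm_le ((h1.mul_const _).div_const _) (Eventually.of_forall fun ζ => ?_)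
  rw [le_div_iff₀ (Real.exp_pos _), norm_mul]
  have h2 : ω ξ ≤ ω ζ + ω (ξ - ζ) := by simpa using ω.subadd ζ (ξ - ζ)
  calc ‖𝓕 (η : E d → ℂ) ζ‖ * ‖𝓕 ψ (ξ - ζ)‖ * Real.exp (l * ω ξ)
      ≤ ‖𝓕 (η : E d → ℂ) ζ‖ * ‖𝓕 ψ (ξ - ζ)‖ * (Real.exp (l * ω ζ) * Real.exp (l * ω (ξ - ζ))) := by
        rw [← Real.exp_add, ← mul_add]
        gcongr
    _ = ‖𝓕 (η : E d → ℂ) ζ‖ * Real.exp (l * ω ζ) *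
        (‖𝓕 ψ (ξ - ζ)‖ * Real.exp (l * ω (ξ - ζ))) := by ring
    _ ≤ _ := by
        gcongr
        exact mul_exp_le_fnorm hψl _

variable {t : UType} {ω : Weight d}

/-- The product of a test function of Beurling type and a test function. -/
def Test.mul (η : Test UType.beurling ω) (ψ : Test t ω) : Test t ω :=
  ⟨fun x => η x * ψ x, η.2.1.mul ψ.2.1, η.2.2.1.mul_right,
    UType.quant_mono ψ.2.2.2 fun _ hl h => fnorm_mul_lt_top η hl ψ.integrable h⟩

/-- The inclusion of the test functions into the space of all functions. -/
def Test.coeₗ : Test t ω →ₗ[ℂ] (E d → ℂ) where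
  toFun φ := φ
  map_add' _ _ := rfl
  map_smul' _ _ := rfl

theorem Test.sum_apply {ι : Type*} (F : Finset ι) (φ : ι → Test t ω) (x : E d) :
    (∑ i ∈ F, φ i : Test t ω) x = ∑ i ∈ F, φ i x := by
  have : Test.coeₗ (∑ i ∈ F, φ i) = ∑ i ∈ F, Test.coeₗ (φ i) := map_sum _ _ _
  exact (congrFun this x).trans (Finset.sum_apply x F _)

/-! ### Test functions and rapidly decreasing sequences -/

theorem continuous_of_comp_mem {V W : Type*} [AddCommGroup V] [Module ℂ V] [TopologicalSpace V]
    [AddCommGroup W] [Module ℂ W] [TopologicalSpace W] {S : Set (Seminorm ℂ V)}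
    {S' : Set (Seminorm ℂ W)} [Nonempty S] [Nonempty S']
    (hS : WithSeminorms (fun p : S => (p : Seminorm ℂ V)))
    (hS' : WithSeminorms (fun p : S' => (p : Seminorm ℂ W))) (T : V →ₗ[ℂ] W)
    (h : ∀ p ∈ S', p.comp T ∈ S) : Continuous T := by
  refine WithSeminorms.continuous_of_isBounded hS hS' T fun p => ⟨{⟨_, h p p.2⟩}, 1, ?_⟩
  rw [Finset.sup_singleton, one_smul]

variable (Λ : Submodule ℤ (E d))

theorem snorm_fourier_le (l : ℝ) (φ : E d → ℂ) :
    snorm ω (dualLattice Λ) l (fun ν => ∫ x, φ x * Test.expFun ν x) ≤ fnorm ω l φ := by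
  refine iSup_le fun ν => ?_
  beta_reduce
  rw [integral_mul_expFun, ← ω.even]
  exact fnorm_le_iff.1 le_rfl (-(ν : E d))

variable (t ω) in
/-- The Fourier coefficients `∫ φ e_ν` of the periodization of a test function `φ`. -/
def Test.coeffₗ : Test t ω →ₗ[ℂ] Rapid t ω (dualLattice Λ) where
  toFun φ := ⟨fun ν => ∫ x, φ x * Test.expFun ν x,
    UType.quant_mono φ.2.2.2 fun l _ h => (snorm_fourier_le Λ l φ).trans_lt h⟩
  map_add' φ ψ := Subtype.ext (funext fun ν => (expDist t ω (ν : E d)).map_add φ ψ)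
  map_smul' c φ := Subtype.ext (funext fun ν => (expDist t ω (ν : E d)).map_smul c φ)

variable (t ω) in
/-- The continuous linear map `Test.coeffₗ`. -/
def Test.coeff : Test t ω →L[ℂ] Rapid t ω (dualLattice Λ) where
  toLinearMap := Test.coeffₗ t ω Λ
  cont := by
    refine continuous_of_comp_mem Test.withSeminorms Rapid.withSeminorms _ fun p hp K _ => ?_
    refine UType.coquant_mono hp ?_
    rintro l - ⟨C, hC⟩
    refine ⟨C, fun φ _ => (hC _).trans ?_⟩
    gcongr
    exact snorm_fourier_le Λ l φ

variable {Λ}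

/-- The trigonometric series with coefficients `s`. -/
def trigSeries (s : dualLattice Λ → ℂ) (x : E d) : ℂ :=
  ∑' ν : dualLattice Λ, s ν * Test.expFun (-(ν : E d)) x

theorem Rapid.summable_norm
    (hM : t.coquant fun k => Summable fun μ : dualLattice Λ => Real.exp (-(k * ω μ)))
    (s : Rapid t ω (dualLattice Λ)) : Summable fun ν => ‖s ν‖ := by
  obtain ⟨l, k, hl, hk0, hs, -, hk⟩ := UType.exists_split s.2 hM hM
  refine Summable.of_nonneg_of_le (fun _ => norm_nonneg _) (fun ν => ?_)
    (hk.mul_left (snorm ω (dualLattice Λ) (l + k) s).toReal)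
  refine (norm_le_snorm hs ν).trans ?_
  gcongr
  · exact ω.nonneg _
  · linarith

theorem summable_trigSeries {s : dualLattice Λ → ℂ} (hs : Summable fun ν => ‖s ν‖) (x : E d) :
    Summable fun ν : dualLattice Λ => s ν * Test.expFun (-(ν : E d)) x :=
  Summable.of_norm (by simpa only [norm_mul, norm_expFun, mul_one] using hs)

theorem continuous_trigSeries {s : dualLattice Λ → ℂ} (hs : Summable fun ν => ‖s ν‖) :
    Continuous (trigSeries s) :=
  continuous_tsum (fun ν => continuous_const.mul (continuous_expFun _)) hs fun ν x => by
    rw [norm_mul, norm_expFun, mul_one]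

theorem hasSum_fourier_mul_trigSeries [Countable (dualLattice Λ)] {η : E d → ℂ} (hη : Integrable η)
    {s : dualLattice Λ → ℂ} (hs : Summable fun ν => ‖s ν‖) (ξ : E d) :
    HasSum (fun ν : dualLattice Λ => s ν * 𝓕 η (ξ + ν))
      (𝓕 (fun x => η x * trigSeries s x) ξ) := by
  have hint : ∀ y : E d, Integrable fun x => η x * Test.expFun y x := fun y =>
    hη.mul_bdd (c := 1) (continuous_expFun y).aestronglyMeasurable
      (Eventually.of_forall fun x => (norm_expFun y x).le)
  have h1 : ∀ ν : dualLattice Λ,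
      ∫ x, s ν * (η x * Test.expFun (-ξ - (ν : E d)) x) = s ν * 𝓕 η (ξ + ν) := fun ν => by
    rw [integral_const_mul, integral_mul_expFun]
    congr 2
    rw [neg_sub, sub_neg_eq_add, add_comm]
  have h2 := hasSum_integral_of_summable_integral_norm (μ := volume)
    (F := fun (ν : dualLattice Λ) x => s ν * (η x * Test.expFun (-ξ - (ν : E d)) x))
    (fun ν => (hint _).const_mul _) (by
      simp only [norm_mul, norm_expFun, mul_one, integral_const_mul]
      exact hs.mul_right _)
  simp_rw [h1] at h2
  convert! h2 using 1
  rw [← neg_neg ξ, ← integral_mul_expFun]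
  congr 1
  ext x
  simp only [neg_neg, sub_eq_add_neg, expFun_add_left]
  have h3 : ∀ ν : dualLattice Λ, s ν * (η x * (Test.expFun (-ξ) x * Test.expFun (-(ν : E d)) x)) =
      η x * Test.expFun (-ξ) x * (s ν * Test.expFun (-(ν : E d)) x) := fun ν => by ring
  simp_rw [h3]
  rw [tsum_mul_left, trigSeries]
  ring

/-- The transform is ∑ s_ν η̂(ξ + ν), and ω(ξ) ≤ ω(ξ + ν) + ω(ν) distributes the weight over the two
factors. The extra k in the norm of s pays for the summation. -/
theorem fnorm_mul_trigSeries_le [Countable (dualLattice Λ)] {η : E d → ℂ} (hη : Integrable η)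
    {s : dualLattice Λ → ℂ} (hs : Summable fun ν => ‖s ν‖) {l k : ℝ} (hl : 0 < l)
    (hηl : fnorm ω l η < ∞) (hsl : snorm ω (dualLattice Λ) (l + k) s < ∞)
    (hk : Summable fun μ : dualLattice Λ => Real.exp (-(k * ω μ))) :
    fnorm ω l (fun x => η x * trigSeries s x) ≤
      ENNReal.ofReal ((fnorm ω l η).toReal * (∑' μ : dualLattice Λ, Real.exp (-(k * ω μ))) *
        (snorm ω (dualLattice Λ) (l + k) s).toReal) := by
  refine fnorm_le_ofReal fun ξ => ?_
  rw [← (hasSum_fourier_mul_trigSeries hη hs ξ).tsum_eq, ← le_div_iff₀ (Real.exp_pos _)]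
  refine tsum_of_norm_bounded (((hk.hasSum.mul_left (fnorm ω l η).toReal).mul_right
    (snorm ω (dualLattice Λ) (l + k) s).toReal).div_const _) fun ν => ?_
  rw [le_div_iff₀ (Real.exp_pos _), norm_mul]
  have h1 : ω ξ ≤ ω (ξ + ν) + ω ν := by
    have := ω.subadd (ξ + ν) (-ν)
    rwa [add_neg_cancel_right, ω.even] at this
  calc ‖s ν‖ * ‖𝓕 η (ξ + ν)‖ * Real.exp (l * ω ξ)
      ≤ ‖s ν‖ * ‖𝓕 η (ξ + ν)‖ * Real.exp (l * (ω (ξ + ν) + ω ν)) := by gcongr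
    _ = (‖𝓕 η (ξ + ν)‖ * Real.exp (l * ω (ξ + ν))) * Real.exp (-(k * ω ν)) *
        (‖s ν‖ * Real.exp ((l + k) * ω ν)) := by
        have : Real.exp (l * (ω (ξ + ν) + ω ν)) = Real.exp (l * ω (ξ + ν)) *
            Real.exp (-(k * ω ν)) * Real.exp ((l + k) * ω ν) := by
          rw [← Real.exp_add, ← Real.exp_add]
          ring_nf
        rw [this]
        ring
    _ ≤ _ := by
        gcongr
        · exact mul_exp_le_fnorm hηl _
        · exact mul_exp_le_snorm hsl ν

theorem Test.coeff_translate (φ : Test t ω) {μ : E d} (hμ : μ ∈ Λ) :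
    Test.coeff t ω Λ (φ.translate μ) = Test.coeff t ω Λ φ := by
  refine Subtype.ext (funext fun ν => ?_)
  change ∫ x, φ (x - μ) * Test.expFun ν x = ∫ x, φ x * Test.expFun ν x
  rw [← integral_sub_right_eq_self (fun x => φ x * Test.expFun ν x) μ]
  congr 1
  ext x
  rw [← expFun_add_lattice Λ ν.2 hμ (x - μ), sub_add_cancel]

variable [DiscreteTopology Λ]

/-- A periodic ultradistribution vanishes on the test functions with vanishing periodization. -/
theorem apply_eq_zero_of_periodization {f : Dist t ω} (hf : f ∈ periodic t ω Λ)
    {η : Test UType.beurling ω} (hη : IsPartitionOfUnity Λ η) {φ : Test t ω}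
    (h : periodization Λ φ = 0) : f φ = 0 := by
  obtain ⟨F, hF⟩ := exists_finset_periodization Λ η.2.2.1 φ.2.2.1.isCompact.isBounded
  -- The partition of unity cuts φ into pieces η(· + μ) φ. Periodicity of f moves each to η φ(· -
  -- μ), and the sum of these is η times the vanishing periodization. The same finite F serves both
  -- sums.
  have h1 : φ = ∑ μ ∈ F, (η.translate (-(μ : E d))).mul φ := by
    refine Subtype.ext (funext fun x => ?_)
    refine Eq.trans ?_ (Test.sum_apply F _ x).symm
    change φ x = ∑ μ ∈ F, η (x - -(μ : E d)) * φ x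
    simp only [sub_neg_eq_add]
    rw [← Finset.sum_mul]
    by_cases hx : x ∈ tsupport φ
    · rw [← tsum_eq_sum (L := .unconditional Λ) fun μ hμ => hF x hx μ hμ, (hη x).tsum_eq, one_mul]
    · rw [image_eq_zero_of_notMem_tsupport hx, mul_zero]
  have h2 : ∀ μ : Λ, f ((η.translate (-(μ : E d))).mul φ) = f (η.mul (φ.translate μ)) := by
    intro μ
    rw [← hf μ μ.2]
    congr 1
    refine Subtype.ext (funext fun x => ?_)
    change η (x - μ - -(μ : E d)) * φ (x - μ) = η x * φ (x - μ)
    rw [sub_neg_eq_add, sub_add_cancel]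
  have h3 : ∑ μ ∈ F, η.mul (φ.translate (μ : E d)) = 0 := by
    refine Subtype.ext (funext fun x => ?_)
    refine (Test.sum_apply F _ x).trans ?_
    change ∑ μ ∈ F, η x * φ (x - μ) = 0
    have h4 : ∀ μ ∉ F, η x * φ (x - μ) = 0 := by
      intro μ hμ
      by_cases hx : x - μ ∈ tsupport φ
      · have := hF _ hx μ hμ
        rw [sub_add_cancel] at this
        rw [this, zero_mul]
      · rw [image_eq_zero_of_notMem_tsupport hx, mul_zero]
    rw [← tsum_eq_sum (L := .unconditional Λ) h4, tsum_mul_left, ← (Equiv.neg Λ).tsum_eq]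
    simp only [Equiv.neg_apply, Submodule.coe_neg, sub_neg_eq_add]
    have h5 : periodization Λ φ x = 0 := congrFun h x
    rw [periodization] at h5
    rw [h5, mul_zero]
  rw [h1, map_sum, Finset.sum_congr rfl fun μ _ => h2 μ, ← map_sum, h3, map_zero]

variable [IsZLattice ℝ Λ]

instance : Countable (dualLattice Λ) := by
  obtain ⟨b, hb⟩ := exists_basis_dualLattice Λ
  rw [hb]
  infer_instance

/-- The test function `η · ∑ s_ν e_{-ν}` defined by a rapidly decreasing sequence `s`. -/
def Rapid.mulTrigSeries
    (hM : t.coquant fun k => Summable fun μ : dualLattice Λ => Real.exp (-(k * ω μ)))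
    (η : Test UType.beurling ω) (s : Rapid t ω (dualLattice Λ)) : Test t ω :=
  ⟨fun x => η x * trigSeries s x,
    η.2.1.mul (continuous_trigSeries (s.summable_norm hM)), η.2.2.1.mul_right,
    UType.quant_sub s.2 hM fun l _ hl _ hs hk =>
      (fnorm_mul_trigSeries_le η.integrable (s.summable_norm hM) hl (η.2.2.2 l hl) hs hk).trans_lt
        ENNReal.ofReal_lt_top⟩

/-- The linear map `s ↦ η · |Λ|⁻¹ ∑ s_ν e_{-ν}` from the rapidly decreasing sequences to the test
functions. -/
def Rapid.toTestₗ (hM : t.coquant fun k => Summable fun μ : dualLattice Λ => Real.exp (-(k * ω μ)))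
    (η : Test UType.beurling ω) : Rapid t ω (dualLattice Λ) →ₗ[ℂ] Test t ω :=
  (ZLattice.covolume Λ : ℂ)⁻¹ •
    { toFun := Rapid.mulTrigSeries hM η
      map_add' := fun r s => by
        refine Subtype.ext (funext fun x => ?_)
        refine Eq.trans ?_ (mul_add (η x) (trigSeries r x) (trigSeries s x))
        refine congrArg (η x * ·) ?_
        refine Eq.trans ?_ ((summable_trigSeries (r.summable_norm hM) x).tsum_add
          (summable_trigSeries (s.summable_norm hM) x))
        exact tsum_congr fun ν => add_mul (r ν) (s ν) _
      map_smul' := fun a s => by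
        refine Subtype.ext (funext fun x => ?_)
        refine Eq.trans ?_ (mul_left_comm (η x) a (trigSeries s x))
        refine congrArg (η x * ·) ?_
        refine Eq.trans ?_ tsum_mul_left
        exact tsum_congr fun ν => mul_assoc a (s ν) _ }

/-- The continuous linear map `Rapid.toTestₗ`. -/
def Rapid.toTest (hM : t.coquant fun k => Summable fun μ : dualLattice Λ => Real.exp (-(k * ω μ)))
    (η : Test UType.beurling ω) : Rapid t ω (dualLattice Λ) →L[ℂ] Test t ω where
  toLinearMap := Rapid.toTestₗ hM η
  cont := by
    refine continuous_of_comp_mem Rapid.withSeminorms Test.withSeminorms _ fun p hp => ?_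
    -- All image functions are supported in `tsupport η`, so the seminorm needs to be estimated on
    -- this one compact set only.
    refine UType.coquant_add (hp (tsupport η) η.2.2.1) hM ?_
    rintro l k hl - ⟨C, hC⟩ hk
    set a := (ZLattice.covolume Λ : ℂ)⁻¹
    set A := (fnorm ω l η).toReal * ∑' μ : dualLattice Λ, Real.exp (-(k * ω μ)) with hA
    have hA0 : 0 ≤ A :=
      mul_nonneg ENNReal.toReal_nonneg (tsum_nonneg fun _ => (Real.exp_pos _).le)
    have hD : 0 < ‖a‖ * (C * A) + 1 := by positivity
    refine ⟨⟨‖a‖ * (C * A) + 1, hD.le⟩, fun s => ofReal_le_mul_of_toReal hD fun hs => ?_⟩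
    have hsum := s.summable_norm hM
    have h1 := fnorm_mul_trigSeries_le η.integrable hsum hl (η.2.2.2 l hl) hs hk
    change p (a • Rapid.mulTrigSeries hM η s) ≤ _
    rw [map_smul_eq_mul]
    have h2 := hC (Rapid.mulTrigSeries hM η s) (closure_mono (Function.support_mul_subset_left _ _))
    have h3 := le_mul_toReal_of_ofReal_le (h1.trans_lt ENNReal.ofReal_lt_top) h2
    have hS0 : 0 ≤ (snorm ω (dualLattice Λ) (l + k) s).toReal := ENNReal.toReal_nonneg
    have h4 := ENNReal.toReal_le_of_le_ofReal (by positivity) h1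
    calc ‖a‖ * p (Rapid.mulTrigSeries hM η s) ≤ ‖a‖ * (C * (A * (snorm ω (dualLattice Λ) (l + k) s).toReal)) := by
          refine mul_le_mul_of_nonneg_left (h3.trans ?_) (norm_nonneg _)
          exact mul_le_mul_of_nonneg_left h4 C.coe_nonneg
      _ = ‖a‖ * (C * A) * (snorm ω (dualLattice Λ) (l + k) s).toReal := by ring
      _ ≤ _ := mul_le_mul_of_nonneg_right (le_add_of_nonneg_right zero_le_one) hS0

/-! ### Inversion formulas and the isomorphism with the dual -/

theorem Rapid.toTest_apply
    (hM : t.coquant fun k => Summable fun μ : dualLattice Λ => Real.exp (-(k * ω μ)))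
    (η : Test UType.beurling ω) (s : Rapid t ω (dualLattice Λ)) (x : E d) :
    Rapid.toTest hM η s x = (ZLattice.covolume Λ : ℂ)⁻¹ * (η x * trigSeries s x) := rfl

theorem covolume_coe_ne_zero : (ZLattice.covolume Λ : ℂ) ≠ 0 :=
  Complex.ofReal_ne_zero.2 (ZLattice.covolume_ne_zero Λ volume)

theorem integral_partition_mul_expFun_sub {η : E d → ℂ} (hc : Continuous η)
    (hs : HasCompactSupport η) (hη : IsPartitionOfUnity Λ η) (ν μ : dualLattice Λ) :
    ∫ x, η x * Test.expFun ((ν : E d) - (μ : E d)) x = (ZLattice.covolume Λ : ℂ) * unitSeq μ ν := by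
  by_cases h : ν = μ
  · subst h
    simp only [sub_self, expFun_zero_left, mul_one, unitSeq_self]
    exact integral_partition hc hs hη
  · rw [unitSeq_of_ne h, mul_zero]
    refine integral_partition_mul_expFun hc hs hη (Submodule.sub_mem _ ν.2 μ.2) ?_
    rw [sub_ne_zero]
    exact fun h' => h (Subtype.ext h')

/-- Every partition of unity has the integrals |Λ| at 0 and 0 at the other dual lattice points. The
right side no longer contains η, which is the independence of the Fourier coefficients from it. -/
theorem Test.coeff_modulate {η : Test t ω} (hη : IsPartitionOfUnity Λ η) (μ : dualLattice Λ) :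
    Test.coeff t ω Λ (η.modulate (-(μ : E d))) = (ZLattice.covolume Λ : ℂ) • Rapid.unit μ := by
  refine Subtype.ext (funext fun ν => ?_)
  refine Eq.trans ?_ (integral_partition_mul_expFun_sub η.2.1 η.2.2.1 hη ν μ)
  refine integral_congr_ae (Eventually.of_forall fun x => ?_)
  change η x * Test.expFun (-(μ : E d)) x * Test.expFun ν x = _
  rw [mul_assoc, ← expFun_add_left, neg_add_eq_sub]

theorem coeff_toTest
    (hM : t.coquant fun k => Summable fun μ : dualLattice Λ => Real.exp (-(k * ω μ)))
    {η : Test UType.beurling ω} (hη : IsPartitionOfUnity Λ η) (s : Rapid t ω (dualLattice Λ)) :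
    Test.coeff t ω Λ (Rapid.toTest hM η s) = s := by
  refine Subtype.ext (funext fun ν => ?_)
  change ∫ x, Rapid.toTest hM η s x * Test.expFun ν x = s ν
  simp only [Rapid.toTest_apply, mul_assoc]
  rw [integral_const_mul, inv_mul_eq_iff_eq_mul₀ covolume_coe_ne_zero]
  have h1 := hasSum_fourier_mul_trigSeries η.integrable (s.summable_norm hM) (-(ν : E d))
  rw [← integral_mul_expFun] at h1
  simp only [mul_assoc] at h1
  have h2 : ∀ μ : dualLattice Λ, s μ * 𝓕 (η : E d → ℂ) (-(ν : E d) + μ) =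
      s μ * ((ZLattice.covolume Λ : ℂ) * unitSeq μ ν) := fun μ => by
    rw [← integral_partition_mul_expFun_sub η.2.1 η.2.2.1 hη, integral_mul_expFun]
    congr 2
    rw [neg_sub, neg_add_eq_sub]
  simp_rw [h2] at h1
  refine h1.unique ?_
  have h3 := hasSum_single (f := fun μ => s μ * ((ZLattice.covolume Λ : ℂ) * unitSeq μ ν)) ν
    fun μ hμ => by rw [unitSeq_of_ne hμ.symm, mul_zero, mul_zero]
  rwa [unitSeq_self, mul_one, mul_comm] at h3

/-- The numbers ∫ φ e_ν are the integrals of the periodization against e_ν over a fundamental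
domain, so completeness of the characters applies. -/
theorem periodization_eq_zero {φ : Test t ω} (h : Test.coeff t ω Λ φ = 0) :
    periodization Λ φ = 0 := by
  refine eq_zero_of_fourier_coeff Λ (continuous_periodization Λ φ.2.1 φ.2.2.1)
    (fun μ hμ x => periodization_add Λ φ hμ x) fun ν hν => ?_
  rw [← integral_mul_periodic Λ φ.2.1 φ.2.2.1 (continuous_expFun ν)
    fun μ hμ x => expFun_add_lattice Λ hν hμ x]
  exact congrArg (fun s : Rapid t ω (dualLattice Λ) => s ⟨ν, hν⟩) h

/-- By `coeff_toTest` the difference of φ and its image has zero coefficients, hence zero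
periodization, and f does not see it. -/
theorem apply_toTest_coeff
    (hM : t.coquant fun k => Summable fun μ : dualLattice Λ => Real.exp (-(k * ω μ)))
    {η : Test UType.beurling ω} (hη : IsPartitionOfUnity Λ η) {f : Dist t ω}
    (hf : f ∈ periodic t ω Λ) (φ : Test t ω) :
    f (Rapid.toTest hM η (Test.coeff t ω Λ φ)) = f φ := by
  rw [← sub_eq_zero, ← map_sub]
  refine apply_eq_zero_of_periodization hf hη (periodization_eq_zero ?_)
  rw [map_sub, coeff_toTest hM hη, sub_self]

/-- The periodic ultradistributions are the dual space of the rapidly decreasing sequences on the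
dual lattice. -/
def periodicEquiv
    (hM : t.coquant fun k => Summable fun μ : dualLattice Λ => Real.exp (-(k * ω μ)))
    {η : Test UType.beurling ω} (hη : IsPartitionOfUnity Λ η) :
    periodic t ω Λ ≃L[ℂ] (Rapid t ω (dualLattice Λ) →L[ℂ] ℂ) where
  toFun f := (f : Dist t ω).comp (Rapid.toTest hM η)
  invFun g := ⟨g.comp (Test.coeff t ω Λ), fun _ hμ φ =>
    congrArg g (Test.coeff_translate φ hμ)⟩
  map_add' _ _ := rfl
  map_smul' _ _ := rfl
  left_inv f := Subtype.ext (ContinuousLinearMap.ext fun φ => apply_toTest_coeff hM hη f.2 φ)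
  right_inv g := ContinuousLinearMap.ext fun s => congrArg g (coeff_toTest hM hη s)
  -- Both maps are transposes of continuous linear maps, hence continuous for the strong topologies.
  continuous_toFun := (ContinuousLinearMap.precomp ℂ (Rapid.toTest hM η)).continuous.comp
    continuous_subtype_val
  continuous_invFun := (ContinuousLinearMap.precomp ℂ (Test.coeff t ω Λ)).continuous.subtype_mk _

theorem Rapid.toTest_unit
    (hM : t.coquant fun k => Summable fun μ : dualLattice Λ => Real.exp (-(k * ω μ)))
    {η : Test UType.beurling ω} {f : Dist t ω} (hf : f ∈ periodic t ω Λ)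
    (hη : IsPartitionOfUnity Λ η) {χ : Test t ω} (hχ : IsPartitionOfUnity Λ χ)
    (μ : dualLattice Λ) : f (Rapid.toTest hM η (Rapid.unit μ)) = fourierCoeff Λ χ f μ := by
  rw [fourierCoeff, ← apply_toTest_coeff hM hη hf (χ.modulate _), Test.coeff_modulate hχ, map_smul, map_smul,
    smul_eq_mul, inv_mul_cancel_left₀ covolume_coe_ne_zero]

end Ultra

end

/-! ### The main theorem -/

theorem proposition3p3 {d : ℕ} (ω : Ultra.Weight d) (Λ : Submodule ℤ (Ultra.E d))
    [DiscreteTopology Λ] [IsZLattice ℝ Λ] (t : Ultra.UType)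
    (hω : t = Ultra.UType.roumieu → ω.GammaZero) :
    (∃ η : Ultra.Test Ultra.UType.beurling ω, Ultra.IsPartitionOfUnity Λ η) ∧
    ∃ Φ : Ultra.periodic t ω Λ ≃L[ℂ] Ultra.Slow t ω (Ultra.dualLattice Λ),
      (∀ η : Ultra.Test t ω, Ultra.IsPartitionOfUnity Λ η →
        ∀ (f : Ultra.periodic t ω Λ) (μ : Ultra.dualLattice Λ),
          Φ f μ = Ultra.fourierCoeff Λ η f μ) ∧
      (∀ f : Ultra.periodic t ω Λ,
        HasSum (fun μ : Ultra.dualLattice Λ => Φ f μ • Ultra.expDist t ω μ)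
          (f : Ultra.Dist t ω)) ∧
      ∃ Ψ : Ultra.Slow t ω (Ultra.dualLattice Λ) ≃L[ℂ]
          (Ultra.Rapid t ω (Ultra.dualLattice Λ) →L[ℂ] ℂ),
        ∀ (c : Ultra.Slow t ω (Ultra.dualLattice Λ)) (s : Ultra.Rapid t ω (Ultra.dualLattice Λ)),
          HasSum (fun μ : Ultra.dualLattice Λ => c μ * s μ) (Ψ c s) := by
  obtain ⟨η, hη⟩ := Ultra.exists_partitionOfUnity Λ ω
  have hM := Ultra.coquant_summable_exp (Ultra.dualLattice Λ) ω t hω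
  refine ⟨⟨η, hη⟩, (Ultra.periodicEquiv hM hη).trans (Ultra.pairingEquiv hM).symm,
    fun χ hχ f μ => Ultra.Rapid.toTest_unit hM f.2 hη hχ μ, fun f => ?_,
    Ultra.pairingEquiv hM, Ultra.hasSum_pairing hM⟩
  -- T sends a slow sequence to the periodic ultradistribution with these coefficients. Applied to c
  -- = ∑ c_μ δ_μ it gives the Fourier series, once T δ_μ = e_μ is known.
  let T : Ultra.Slow t ω (Ultra.dualLattice Λ) →L[ℂ] Ultra.Dist t ω :=
    (Ultra.periodic t ω Λ).subtypeL ∘L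
      ((Ultra.periodicEquiv hM hη).trans (Ultra.pairingEquiv hM).symm).symm.toContinuousLinearMap
  set c := ((Ultra.periodicEquiv hM hη).trans (Ultra.pairingEquiv hM).symm) f with hc
  have h1 := (Ultra.Slow.hasSum_unit hM c).mapL T
  have h2 : T c = f := congrArg Subtype.val
    (((Ultra.periodicEquiv hM hη).trans (Ultra.pairingEquiv hM).symm).symm_apply_apply f)
  rw [h2] at h1
  refine h1.congr_fun fun μ => ?_
  rw [map_smul]
  congr 1
  ext φ
  exact (Ultra.pairing_unit_left hM μ (Ultra.Test.coeff t ω Λ φ)).symm
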